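/- **Theorem 2.1.** Let $x_1, x_2, \dots$ be countably many commuting variables and let $\mathrm{QSymm}$ be the ring of quasisymmetric functions over $\mathbf Z$: the formal power series $f$ in $x_1, x_2, \dots$ with integer coefficients and of bounded degree such that, for all positive integers $a_1, \dots, a_m$ and all indices $i_1 < \dots < i_m$ and $j_1 < \dots < j_m$, the coefficients of $x_{i_1}^{a_1} \cdots x_{i_m}^{a_m}$ and $x_{j_1}^{a_1} \cdots x_{j_m}^{a_m}$ in $f$ are equal. A composition $\alpha = [a_1, \dots, a_m]$ (a finite sequence of positive integers) also denotes the monomial quasisymmetric function $$\alpha = \sum_{i_1 < \dots < i_m} x_{i_1}^{a_1} \cdots x_{i_m}^{a_m}.$$ A composition is Lyndon if it is nonempty and lexicographically strictly smaller than each of its proper nonempty tails (a proper prefix of a word being smaller than the word). Let $eLYN$ be the set of Lyndon compositions $[a_1, \dots, a_m]$ with $\gcd(a_1, \dots, a_m) = 1$. Let $\lambda_n$, $n \ge 0$, be the operations of the $\lambda$-ring structure on integral power series in $x_1, x_2, \dots$ in which the variables $x_j$ are line elements and the Adams operations are the substitutions $x_j \mapsto x_j^n$; explicitly, for $a = \sum_u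 c_u u$, the sum running over the monomials $u$ in the variables, $$\sum_{n \ge 0} \lambda_n(a) t^n = \prod_u (1 + u t)^{c_u}.$$ For a composition $\alpha$ put $e_n(\alpha) = \lambda_n(\alpha)$. Then the elements $e_n(\alpha)$, $\alpha \in eLYN$, $n \in \{1, 2, \dots\}$, are algebraically independent over $\mathbf Z$ and generate the ring $\mathrm{QSymm}$. So $\mathrm{QSymm}$ is the polynomial ring over $\mathbf Z$ on these elements: there is an isomorphism of rings from the polynomial ring over $\mathbf Z$ with one variable for each pair $(\alpha, n)$, $\alpha \in eLYN$, $n \ge 1$, onto $\mathrm{QSymm}$ that sends the variable of $(\alpha, n)$ to $e_n(\alpha)$. -/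

import Mathlib

/-! ### Quasisymmetric functions

The variables `x_1, x_2, …` are indexed by `ℕ` (only the order of the index set matters), and
functions in infinitely many variables live in the ring of formal power series. -/

/-- `f` is quasisymmetric: its degree is bounded, and the coefficients of
`x_{i_1}^{a_1} ⋯ x_{i_m}^{a_m}` and `x_{j_1}^{a_1} ⋯ x_{j_m}^{a_m}` in `f` agree for all
`i_1 < ⋯ < i_m`, all `j_1 < ⋯ < j_m` and all positive exponents `a_1, …, a_m`. -/
def IsQuasisymmetric (f : MvPowerSeries ℕ ℤ) : Prop :=
  (∃ d : ℕ, ∀ s : ℕ →₀ ℕ, d < s.degree → MvPowerSeries.coeff s f = 0) ∧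
  ∀ (m : ℕ) (a : Fin m → ℕ) (i j : Fin m → ℕ), (∀ k, 0 < a k) → StrictMono i → StrictMono j →
    MvPowerSeries.coeff (∑ k, Finsupp.single (i k) (a k)) f =
      MvPowerSeries.coeff (∑ k, Finsupp.single (j k) (a k)) f

/-- Exponents equal to zero may be allowed in the definition of quasisymmetry. -/
theorem IsQuasisymmetric.coeff_eq {f : MvPowerSeries ℕ ℤ} (hf : IsQuasisymmetric f)
    {m : ℕ} (a : Fin m → ℕ) {i j : Fin m → ℕ} (hi : StrictMono i) (hj : StrictMono j) :
    MvPowerSeries.coeff (∑ k, Finsupp.single (i k) (a k)) f =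
      MvPowerSeries.coeff (∑ k, Finsupp.single (j k) (a k)) f := by
  set S : Finset (Fin m) := Finset.univ.filter (fun k => 0 < a k) with hS
  let e := S.orderIsoOfFin rfl
  have key : ∀ i : Fin m → ℕ, ∑ k, Finsupp.single (i k) (a k) =
      ∑ l : Fin S.card, Finsupp.single (i (e l)) (a (e l)) := by
    intro i
    refine Eq.trans ?_ (e.toEquiv.sum_comp (fun x : S => Finsupp.single (i x) (a x))).symm
    rw [Finset.sum_coe_sort S (fun x => Finsupp.single (i x) (a x)), hS, Finset.sum_filter]
    refine Finset.sum_congr rfl fun k _ => ?_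
    split_ifs with h
    · rfl
    · have : a k = 0 := by omega
      simp [this]
  rw [key i, key j]
  refine hf.2 _ _ _ _ (fun l => ?_) (fun x y h => hi ?_) (fun x y h => hj ?_)
  · exact (Finset.mem_filter.1 (e l).2).2
  · exact e.strictMono h
  · exact e.strictMono h

/-- Monomials that divide `x_{i_1}^{a_1} ⋯ x_{i_m}^{a_m}` are supported on `i_1, …, i_m`. -/
theorem sum_antidiagonal_single {m : ℕ} (a : Fin m → ℕ) {i : Fin m → ℕ} (hi : StrictMono i)
    (F : (ℕ →₀ ℕ) × (ℕ →₀ ℕ) → ℤ) :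
    ∑ p ∈ Finset.HasAntidiagonal.antidiagonal (∑ k, Finsupp.single (i k) (a k)), F p =
      ∑ q ∈ Fintype.piFinset (fun k => Finset.HasAntidiagonal.antidiagonal (a k)),
        F (∑ k, Finsupp.single (i k) (q k).1, ∑ k, Finsupp.single (i k) (q k).2) := by
  have ev : ∀ (b : Fin m → ℕ) (k : Fin m), (∑ k, Finsupp.single (i k) (b k)) (i k) = b k := by
    intro b k
    rw [Finsupp.finsetSum_apply, Finset.sum_eq_single k]
    · simp
    · intro l _ hl
      exact Finsupp.single_eq_of_ne (fun h => hl (hi.injective h.symm))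
    · simp
  have ev' : ∀ (b : Fin m → ℕ) (x : ℕ), x ∉ Set.range i →
      (∑ k, Finsupp.single (i k) (b k)) x = 0 := by
    intro b x hx
    rw [Finsupp.finsetSum_apply]
    exact Finset.sum_eq_zero fun l _ => Finsupp.single_eq_of_ne (fun h => hx ⟨l, h.symm⟩)
  have recon : ∀ u : ℕ →₀ ℕ, (∀ x, x ∉ Set.range i → u x = 0) →
      ∑ k, Finsupp.single (i k) (u (i k)) = u := by
    intro u hu
    ext x
    by_cases hx : x ∈ Set.range i
    · obtain ⟨k, rfl⟩ := hx
      exact ev (fun k => u (i k)) k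
    · rw [ev' _ x hx, hu x hx]
  refine Finset.sum_bij' (fun p _ k => (p.1 (i k), p.2 (i k)))
    (fun q _ => (∑ k, Finsupp.single (i k) (q k).1, ∑ k, Finsupp.single (i k) (q k).2))
    ?_ ?_ ?_ ?_ ?_
  · intro p hp
    rw [Finset.HasAntidiagonal.mem_antidiagonal] at hp
    rw [Fintype.mem_piFinset]
    intro k
    rw [Finset.HasAntidiagonal.mem_antidiagonal, ← ev a k, ← hp, Finsupp.add_apply]
  · intro q hq
    rw [Fintype.mem_piFinset] at hq
    rw [Finset.HasAntidiagonal.mem_antidiagonal, ← Finset.sum_add_distrib]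
    refine Finset.sum_congr rfl fun k _ => ?_
    rw [← Finsupp.single_add, Finset.HasAntidiagonal.mem_antidiagonal.1 (hq k)]
  · intro p hp
    rw [Finset.HasAntidiagonal.mem_antidiagonal] at hp
    have h0 : ∀ x, x ∉ Set.range i → p.1 x = 0 ∧ p.2 x = 0 := by
      intro x hx
      have := ev' a x hx
      rw [← hp, Finsupp.add_apply] at this
      omega
    exact Prod.ext (recon _ fun x hx => (h0 x hx).1) (recon _ fun x hx => (h0 x hx).2)
  · intro q _
    funext k
    exact Prod.ext (ev (fun k => (q k).1) k) (ev (fun k => (q k).2) k)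
  · intro p hp
    rw [Finset.HasAntidiagonal.mem_antidiagonal] at hp
    have h0 : ∀ x, x ∉ Set.range i → p.1 x = 0 ∧ p.2 x = 0 := by
      intro x hx
      have := ev' a x hx
      rw [← hp, Finsupp.add_apply] at this
      omega
    rw [recon _ fun x hx => (h0 x hx).1, recon _ fun x hx => (h0 x hx).2]

/-- The ring `QSymm` of quasisymmetric functions over the integers. -/
def QSymm : Subalgebra ℤ (MvPowerSeries ℕ ℤ) where
  carrier := {f | IsQuasisymmetric f}
  mul_mem' := by
    rintro f g hf hg
    refine ⟨?_, ?_⟩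
    · obtain ⟨d, hd⟩ := hf.1
      obtain ⟨e, he⟩ := hg.1
      refine ⟨d + e, fun s hs => ?_⟩
      rw [MvPowerSeries.coeff_mul]
      refine Finset.sum_eq_zero fun p hp => ?_
      rw [Finset.HasAntidiagonal.mem_antidiagonal] at hp
      rw [← hp, map_add] at hs
      rcases lt_or_ge d p.1.degree with h | h
      · rw [hd _ h, zero_mul]
      · rw [he _ (by omega), mul_zero]
    · intro m a i j _ hi hj
      rw [MvPowerSeries.coeff_mul, MvPowerSeries.coeff_mul, sum_antidiagonal_single a hi,
        sum_antidiagonal_single a hj]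
      refine Finset.sum_congr rfl fun q _ => ?_
      dsimp only
      rw [hf.coeff_eq _ hi hj, hg.coeff_eq _ hi hj]
  add_mem' := by
    rintro f g hf hg
    refine ⟨?_, ?_⟩
    · obtain ⟨d, hd⟩ := hf.1
      obtain ⟨e, he⟩ := hg.1
      refine ⟨d + e, fun s hs => ?_⟩
      rw [map_add, hd _ (by omega), he _ (by omega), add_zero]
    · intro m a i j ha hi hj
      rw [map_add, map_add, hf.2 m a i j ha hi hj, hg.2 m a i j ha hi hj]
  algebraMap_mem' := by
    intro r
    have hc : ∀ s : ℕ →₀ ℕ, MvPowerSeries.coeff s (algebraMap ℤ (MvPowerSeries ℕ ℤ) r) =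
        if s.degree = 0 then r else 0 := by
      intro s
      rw [MvPowerSeries.algebraMap_apply, MvPowerSeries.coeff_C]
      simp [Finsupp.degree_eq_zero_iff]
    refine ⟨⟨0, fun s hs => ?_⟩, fun m a i j _ _ _ => ?_⟩
    · rw [hc, if_neg (by omega)]
    · rw [hc, hc]
      simp

/-- The monomial quasisymmetric function of a composition `α = [a_1, …, a_m]` (all `a_i > 0`),
`∑_{i_1 < ⋯ < i_m} x_{i_1}^{a_1} ⋯ x_{i_m}^{a_m}`: the coefficient of a monomial is `1` if its
nonzero exponents, read in increasing order of the variables, are `a_1, …, a_m`, and else `0`. -/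
noncomputable def monomialQSymm (α : List ℕ) : MvPowerSeries ℕ ℤ :=
  fun s => if (s.support.sort (· ≤ ·)).map s = α then 1 else 0

/-! ### Elementary Lyndon compositions -/

/-- A Lyndon word: a nonempty word that is lexicographically smaller than each of its proper
nonempty tails (`<` on lists is the lexicographic order, proper prefixes being smaller). -/
def IsLyndonWord (α : List ℕ) : Prop :=
  α ≠ [] ∧ ∀ u v : List ℕ, α = u ++ v → u ≠ [] → v ≠ [] → α < v

/-- The set of elementary Lyndon compositions: words in the positive integers that are Lyndon and
whose entries have greatest common divisor `1`. -/
def eLYN : Set (List ℕ) :=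
  {α | (∀ a ∈ α, 0 < a) ∧ IsLyndonWord α ∧ (α : Multiset ℕ).gcd = 1}

/-! ### The lambda-ring structure on power series in which the variables are line elements -/

/-- A lambda-ring structure on a commutative ring without additive torsion. The laws are those of a
pre-lambda-ring, together with the requirement that the associated Adams operations, which the
Newton relations determine (they say `t d/dt log λ_t(a) = ∑_{n ≥ 1} (-1)^{n-1} ψ_n(a) t^n`), are
ring endomorphisms with `ψ_m ∘ ψ_n = ψ_{mn}`; on torsion-free rings this is equivalent to the
identities that express `λ_n(ab)` and `λ_m(λ_n(a))` through universal polynomials.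
`adams n` is `ψ_{n+1}`. -/
structure LambdaRingStructure (R : Type*) [CommRing R] [IsAddTorsionFree R] where
  /-- the operations `λ_n` -/
  lam : ℕ → R → R
  lam_zero : ∀ a, lam 0 a = 1
  lam_one : ∀ a, lam 1 a = a
  lam_add : ∀ n a b, lam n (a + b) =
    ∑ p ∈ Finset.HasAntidiagonal.antidiagonal n, lam p.1 a * lam p.2 b
  /-- `adams n` is the Adams operation `ψ_{n+1}` -/
  adams : ℕ → R →+* R
  newton : ∀ n a, ((n + 1 : ℕ) : R) * lam (n + 1) a =
    ∑ p ∈ Finset.HasAntidiagonal.antidiagonal n, (-1) ^ p.1 * adams p.1 a * lam p.2 a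
  adams_adams : ∀ m n a, adams m (adams n a) = adams ((m + 1) * (n + 1) - 1) a

/-- `x` is a line element: `λ_t(x) = 1 + x t`. -/
def LambdaRingStructure.IsLineElement {R : Type*} [CommRing R] [IsAddTorsionFree R]
    (L : LambdaRingStructure R) (x : R) : Prop :=
  ∀ n, 2 ≤ n → L.lam n x = 0

namespace PowerSeriesLambda

/-- `(1 + x^m t)^c`, for an exponent `m` and an integer `c`, as a power series in `t`
(binomial expansion). -/
noncomputable def factor (c : ℤ) (m : ℕ →₀ ℕ) : PowerSeries (MvPowerSeries ℕ ℤ) :=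
  PowerSeries.mk fun k => MvPowerSeries.monomial (k • m) (Ring.choose c k)

/-- The product of `(1 + x^m t)^{c_m}` over the monomials `x^m`, `m ∈ S`, where `c_m` is the
coefficient of `x^m` in `a`. -/
noncomputable def partialProd (a : MvPowerSeries ℕ ℤ) (S : Finset (ℕ →₀ ℕ)) :
    PowerSeries (MvPowerSeries ℕ ℤ) :=
  ∏ m ∈ S, factor (MvPowerSeries.coeff m a) m

/-- The operations `λ_n` on power series: if `a = ∑_m c_m x^m` then
`∑_n λ_n(a) t^n = ∏_m (1 + x^m t)^{c_m}`. Only the monomials `x^m` that divide `x^s` contribute to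
the coefficient of `x^s`, so that the product over these is all that is needed. -/
noncomputable def lam (n : ℕ) (a : MvPowerSeries ℕ ℤ) : MvPowerSeries ℕ ℤ :=
  fun s => MvPowerSeries.coeff s (PowerSeries.coeff n (partialProd a (Finset.Iic s)))

theorem coeff_lam (n : ℕ) (a : MvPowerSeries ℕ ℤ) (s : ℕ →₀ ℕ) :
    MvPowerSeries.coeff s (lam n a) =
      MvPowerSeries.coeff s (PowerSeries.coeff n (partialProd a (Finset.Iic s))) := rfl

theorem coeff_factor (c : ℤ) (m : ℕ →₀ ℕ) (k : ℕ) :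
    PowerSeries.coeff k (factor c m) = MvPowerSeries.monomial (k • m) (Ring.choose c k) := by
  rw [factor, PowerSeries.coeff_mk]

theorem coeff_partialProd_zero (a : MvPowerSeries ℕ ℤ) (S : Finset (ℕ →₀ ℕ)) :
    PowerSeries.coeff 0 (partialProd a S) = 1 := by
  rw [PowerSeries.coeff_zero_eq_constantCoeff_apply, partialProd, map_prod]
  refine Finset.prod_eq_one fun m _ => ?_
  rw [← PowerSeries.coeff_zero_eq_constantCoeff_apply, coeff_factor, Ring.choose_zero_right,
    zero_smul, MvPowerSeries.monomial_zero_one]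

/-- Enlarging the product beyond the divisors of `x^s` does not change the coefficient of `x^s`. -/
theorem coeff_partialProd_of_subset (a : MvPowerSeries ℕ ℤ) {S : Finset (ℕ →₀ ℕ)}
    {s : ℕ →₀ ℕ} (hS : Finset.Iic s ⊆ S) (n : ℕ) :
    MvPowerSeries.coeff s (PowerSeries.coeff n (partialProd a S)) =
      MvPowerSeries.coeff s (lam n a) := by
  have key : ∀ T : Finset (ℕ →₀ ℕ), Disjoint (Finset.Iic s) T →
      MvPowerSeries.coeff s (PowerSeries.coeff n (partialProd a (Finset.Iic s ∪ T))) =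
        MvPowerSeries.coeff s (lam n a) := by
    intro T
    induction T using Finset.induction_on with
    | empty => intro _; rw [Finset.union_empty, coeff_lam]
    | insert m T hm ih =>
      intro hd
      rw [Finset.disjoint_insert_right] at hd
      rw [← ih hd.2, Finset.union_insert]
      have hms : ¬ m ≤ s := by simpa using hd.1
      rw [partialProd, Finset.prod_insert (by simp [hms, hm]), PowerSeries.coeff_mul, map_sum,
        Finset.sum_eq_single (0, n)]
      · rw [coeff_factor, Ring.choose_zero_right, zero_smul, MvPowerSeries.monomial_zero_one,
          one_mul]
        rfl
      · rintro ⟨i, j⟩ hij hne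
        rw [Finset.HasAntidiagonal.mem_antidiagonal] at hij
        have hi : i ≠ 0 := by
          rintro rfl
          apply hne
          simp at hij
          simp [hij]
        rw [coeff_factor, MvPowerSeries.coeff_monomial_mul, if_neg]
        intro hle
        exact hms ((le_self_nsmul (zero_le (a := m)) hi).trans hle)
      · intro h
        simp at h
  rw [← Finset.union_sdiff_of_subset hS]
  exact key _ Finset.disjoint_sdiff

theorem coeff_mul_congr {f f' g g' : MvPowerSeries ℕ ℤ} {s : ℕ →₀ ℕ}
    (hf : ∀ u ≤ s, MvPowerSeries.coeff u f = MvPowerSeries.coeff u f')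
    (hg : ∀ u ≤ s, MvPowerSeries.coeff u g = MvPowerSeries.coeff u g') :
    MvPowerSeries.coeff s (f * g) = MvPowerSeries.coeff s (f' * g') := by
  rw [MvPowerSeries.coeff_mul, MvPowerSeries.coeff_mul]
  refine Finset.sum_congr rfl fun p hp => ?_
  rw [Finset.HasAntidiagonal.mem_antidiagonal] at hp
  rw [hf _ (hp ▸ le_self_add), hg _ (hp ▸ le_add_self)]

theorem coeff_partialProd_of_le (a : MvPowerSeries ℕ ℤ) {s u : ℕ →₀ ℕ} (h : u ≤ s) (n : ℕ) :
    MvPowerSeries.coeff u (PowerSeries.coeff n (partialProd a (Finset.Iic s))) =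
      MvPowerSeries.coeff u (lam n a) :=
  coeff_partialProd_of_subset a (Finset.Iic_subset_Iic.2 h) n

theorem lam_zero (a : MvPowerSeries ℕ ℤ) : lam 0 a = 1 := by
  ext s
  rw [coeff_lam, coeff_partialProd_zero]

theorem factor_add (c d : ℤ) (m : ℕ →₀ ℕ) : factor (c + d) m = factor c m * factor d m := by
  ext1 k
  rw [PowerSeries.coeff_mul, coeff_factor, Ring.add_choose_eq k (Commute.all c d), map_sum]
  refine Finset.sum_congr rfl fun p hp => ?_
  rw [Finset.HasAntidiagonal.mem_antidiagonal] at hp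
  rw [coeff_factor, coeff_factor, MvPowerSeries.monomial_mul_monomial, ← add_smul, hp]

theorem lam_add (n : ℕ) (a b : MvPowerSeries ℕ ℤ) :
    lam n (a + b) = ∑ p ∈ Finset.HasAntidiagonal.antidiagonal n, lam p.1 a * lam p.2 b := by
  ext s
  have h : partialProd (a + b) (Finset.Iic s) =
      partialProd a (Finset.Iic s) * partialProd b (Finset.Iic s) := by
    simp only [partialProd, map_add, factor_add, Finset.prod_mul_distrib]
  rw [coeff_lam, h, PowerSeries.coeff_mul, map_sum, map_sum]
  exact Finset.sum_congr rfl fun p _ => coeff_mul_congr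
    (fun u hu => coeff_partialProd_of_le a hu _) (fun u hu => coeff_partialProd_of_le b hu _)

/-- The logarithmic derivative of `(1 + x^m t)^c`. -/
noncomputable def logDer (c : ℤ) (m : ℕ →₀ ℕ) : PowerSeries (MvPowerSeries ℕ ℤ) :=
  PowerSeries.mk fun i => MvPowerSeries.monomial ((i + 1) • m) ((-1) ^ i * c)

theorem choose_succ_mul (c : ℤ) (k : ℕ) :
    (k + 1 : ℤ) * Ring.choose c (k + 1) = (c - k) * Ring.choose c k := by
  have h1 := Ring.choose_smul_choose c (n := k + 1) (k := k) (by omega)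
  simp only [Nat.choose_succ_self_right, add_tsub_cancel_left,
    Ring.choose_one_right, nsmul_eq_mul] at h1
  push_cast at h1
  rw [h1, mul_comm]

theorem choose_newton (c : ℤ) (k : ℕ) :
    (k + 1 : ℤ) * Ring.choose c (k + 1) =
      ∑ p ∈ Finset.HasAntidiagonal.antidiagonal k, (-1) ^ p.1 * c * Ring.choose c p.2 := by
  induction k with
  | zero => simp
  | succ k ih =>
    rw [Finset.Nat.sum_antidiagonal_succ]
    have h2 : ∑ p ∈ Finset.HasAntidiagonal.antidiagonal k, (-1 : ℤ) ^ (p.1 + 1) * c * Ring.choose c p.2 =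
        - ((k + 1 : ℤ) * Ring.choose c (k + 1)) := by
      rw [ih, ← Finset.sum_neg_distrib]
      exact Finset.sum_congr rfl fun p _ => by ring
    rw [h2]
    have h3 := choose_succ_mul c (k + 1)
    push_cast at h3 ⊢
    rw [h3]
    ring

theorem derivative_factor (c : ℤ) (m : ℕ →₀ ℕ) :
    PowerSeries.derivative (MvPowerSeries ℕ ℤ) (factor c m) = logDer c m * factor c m := by
  ext1 k
  have h : ∀ p ∈ Finset.HasAntidiagonal.antidiagonal k, PowerSeries.coeff p.1 (logDer c m) *
      PowerSeries.coeff p.2 (factor c m) =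
      MvPowerSeries.monomial ((k + 1) • m) ((-1) ^ p.1 * c * Ring.choose c p.2) := by
    intro p hp
    rw [Finset.HasAntidiagonal.mem_antidiagonal] at hp
    rw [logDer, PowerSeries.coeff_mk, coeff_factor, MvPowerSeries.monomial_mul_monomial,
      ← add_smul, show p.1 + 1 + p.2 = k + 1 by omega]
  rw [PowerSeries.coeff_mul, Finset.sum_congr rfl h, ← map_sum, ← choose_newton,
    PowerSeries.coeff_derivative, coeff_factor]
  have h' : ((k : MvPowerSeries ℕ ℤ) + 1) = MvPowerSeries.monomial 0 ((k : ℤ) + 1) := by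
    rw [MvPowerSeries.monomial_zero_eq_C_apply]
    simp
  rw [h', MvPowerSeries.monomial_mul_monomial, add_zero, mul_comm]

theorem derivative_partialProd (a : MvPowerSeries ℕ ℤ) (S : Finset (ℕ →₀ ℕ)) :
    PowerSeries.derivative (MvPowerSeries ℕ ℤ) (partialProd a S) =
      (∑ m ∈ S, logDer (MvPowerSeries.coeff m a) m) * partialProd a S := by
  induction S using Finset.induction_on with
  | empty => simp [partialProd]
  | insert m S hm ih =>
    have h : partialProd a (insert m S) =
        factor (MvPowerSeries.coeff m a) m * partialProd a S := Finset.prod_insert hm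
    rw [h, Finset.sum_insert hm, Derivation.leibniz, ih, derivative_factor, smul_eq_mul,
      smul_eq_mul]
    ring

/-- The ring endomorphism `x_j ↦ x_j^{n+1}` of the ring of power series. -/
noncomputable def adams (n : ℕ) : MvPowerSeries ℕ ℤ →+* MvPowerSeries ℕ ℤ :=
  (MvPowerSeries.expand (n + 1) n.succ_ne_zero).toRingHom

theorem coeff_sum_logDer (a : MvPowerSeries ℕ ℤ) {s u : ℕ →₀ ℕ} (h : u ≤ s) (i : ℕ) :
    MvPowerSeries.coeff u (PowerSeries.coeff i
      (∑ m ∈ Finset.Iic s, logDer (MvPowerSeries.coeff m a) m)) =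
    MvPowerSeries.coeff u ((-1) ^ i * adams i a) := by
  have hneg : ((-1) ^ i * adams i a : MvPowerSeries ℕ ℤ) =
      MvPowerSeries.C ((-1) ^ i : ℤ) * adams i a := by
    simp
  rw [hneg, MvPowerSeries.coeff_C_mul, map_sum, map_sum]
  simp only [logDer, PowerSeries.coeff_mk, MvPowerSeries.coeff_monomial]
  by_cases hu : ∃ v, u = (i + 1) • v
  · obtain ⟨v, rfl⟩ := hu
    have hv : v ≤ s := (le_self_nsmul (zero_le (a := v)) (Nat.succ_ne_zero i)).trans h
    rw [Finset.sum_eq_single v]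
    · rw [if_pos rfl]
      exact congrArg _ (MvPowerSeries.coeff_expand_smul _ _ _ _).symm
    · intro w _ hw
      rw [if_neg]
      intro hvw
      exact hw (nsmul_right_injective (Nat.succ_ne_zero i) hvw).symm
    · intro hv'
      exact absurd (Finset.mem_Iic.2 hv) hv'
  · rw [Finset.sum_eq_zero]
    · have : ∃ j, ¬ (i + 1) ∣ u j := by
        by_contra! hc
        refine hu ⟨u.mapRange (· / (i + 1)) (Nat.zero_div _), ?_⟩
        ext j
        simp [Nat.mul_div_cancel' (hc j)]
      obtain ⟨j, hj⟩ := this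
      have h0 : MvPowerSeries.coeff u (adams i a) = 0 :=
        MvPowerSeries.coeff_expand_of_not_dvd _ _ _ hj
      rw [h0, mul_zero]
    · intro w _
      rw [if_neg fun hw => hu ⟨w, hw⟩]

theorem newton (n : ℕ) (a : MvPowerSeries ℕ ℤ) :
    ((n + 1 : ℕ) : MvPowerSeries ℕ ℤ) * lam (n + 1) a =
      ∑ p ∈ Finset.HasAntidiagonal.antidiagonal n, (-1) ^ p.1 * adams p.1 a * lam p.2 a := by
  ext s
  have h := congrArg (fun f => MvPowerSeries.coeff s (PowerSeries.coeff n f))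
    (derivative_partialProd a (Finset.Iic s))
  simp only [PowerSeries.coeff_derivative, PowerSeries.coeff_mul, map_sum] at h
  rw [map_sum]
  refine Eq.trans ?_ (h.trans (Finset.sum_congr rfl fun p _ => ?_))
  · rw [mul_comm]
    push_cast
    refine coeff_mul_congr (fun u hu => ?_) (fun _ _ => rfl)
    rw [coeff_partialProd_of_le a hu]
  · refine coeff_mul_congr (fun u hu => ?_) (fun u hu => coeff_partialProd_of_le a hu _)
    rw [← coeff_sum_logDer a hu, map_sum, map_sum, map_sum]

theorem lam_one (a : MvPowerSeries ℕ ℤ) : lam 1 a = a := by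
  have h := newton 0 a
  simpa [lam_zero, adams] using h

theorem adams_adams (m n : ℕ) (a : MvPowerSeries ℕ ℤ) :
    adams m (adams n a) = adams ((m + 1) * (n + 1) - 1) a := by
  have h := (MvPowerSeries.expand_mul (m + 1) m.succ_ne_zero (n + 1) n.succ_ne_zero a).symm
  refine h.trans ?_
  have e : (m + 1) * (n + 1) = (m + 1) * (n + 1) - 1 + 1 :=
    (Nat.sub_add_cancel (Nat.mul_pos m.succ_pos n.succ_pos)).symm
  change _ = MvPowerSeries.expand ((m + 1) * (n + 1) - 1 + 1) _ a
  congr 2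

/-- Monomials, in particular the variables, are line elements. -/
theorem lam_monomial (m : ℕ →₀ ℕ) (n : ℕ) (hn : 2 ≤ n) :
    lam n (MvPowerSeries.monomial m (1 : ℤ)) = 0 := by
  ext s
  have h0 : ∀ w, factor 0 w = 1 := by
    intro w
    ext1 k
    rw [coeff_factor, PowerSeries.coeff_one, Ring.choose_zero_ite]
    split_ifs with hk
    · rw [hk, zero_smul, MvPowerSeries.monomial_zero_one]
    · rw [map_zero]
  have h : partialProd (MvPowerSeries.monomial m (1 : ℤ)) (insert m (Finset.Iic s)) =
      factor 1 m := by
    rw [partialProd, Finset.prod_eq_single m]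
    · rw [MvPowerSeries.coeff_monomial_same]
    · intro w _ hw
      rw [MvPowerSeries.coeff_monomial_ne hw, h0]
    · simp
  rw [← coeff_partialProd_of_subset _ (Finset.subset_insert m (Finset.Iic s)), h, coeff_factor]
  have hc : Ring.choose (1 : ℤ) n = 0 := by
    have := Ring.choose_natCast (R := ℤ) 1 n
    rw [Nat.choose_eq_zero_of_lt (by omega)] at this
    simpa using this
  rw [hc, map_zero]

end PowerSeriesLambda

instance : IsAddTorsionFree (MvPowerSeries ℕ ℤ) :=
  inferInstanceAs (IsAddTorsionFree ((ℕ →₀ ℕ) → ℤ))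

/-- The lambda-ring structure on integral power series in `x_1, x_2, …` in which the variables are
line elements and the Adams operations are the substitutions `x_j ↦ x_j^n`. -/
noncomputable def powerSeriesLambda : LambdaRingStructure (MvPowerSeries ℕ ℤ) where
  lam := PowerSeriesLambda.lam
  lam_zero := PowerSeriesLambda.lam_zero
  lam_one := PowerSeriesLambda.lam_one
  lam_add := PowerSeriesLambda.lam_add
  adams := PowerSeriesLambda.adams
  newton := PowerSeriesLambda.newton
  adams_adams := PowerSeriesLambda.adams_adams


theorem powerSeriesLambda_isLineElement_X (j : ℕ) :
    powerSeriesLambda.IsLineElement (MvPowerSeries.X j) :=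
  fun n hn => PowerSeriesLambda.lam_monomial _ n hn

/-- `e_n(α) = λ_n(α)`, where `α` stands for the monomial quasisymmetric function of `α`. -/
noncomputable def eQSymm (n : ℕ) (α : List ℕ) : MvPowerSeries ℕ ℤ :=
  powerSeriesLambda.lam n (monomialQSymm α)

/-! ### Lexicographic order and shuffles of words -/

namespace Word

/-! Generation. In the basis of monomial quasisymmetric functions the product is the quasi-shuffle
product, and its longest words are those of the ordinary shuffle product (`QuasiSym.top_mul`). Order
words by length, then lexicographically. For a Lyndon word `l`, all terms but one of the Newton
relation for `λ_{n+1}(l)` consist of shorter words, so the longest part of `λ_n(l)` is the `n`-th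
divided shuffle power of `l`. Its largest word is `l ^ n`, and the division by `n!` makes the
coefficient exactly `1` (`Word.leads_pow`, `QuasiSym.hasLeadingWord_lam`). Splitting off from a word
the maximal power of its minimal suffix, again and again, gives a product of such `λ_n(l)` whose
leading word is the given one, with coefficient `1` (`QuasiSym.exists_hasLeadingWord`).
Unitriangularity then shows that the `λ_n(l)`, for all Lyndon compositions `l`, generate `QSymm`
over the integers.

To pass to elementary Lyndon compositions, write `l = dβ` with `d` the gcd of the entries. Then `l =
ψ_d(β)`, and `λ_n(ψ_d(β))` is an integral polynomial in the `λ_k(β)`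
(`PowerSeriesLambda.lam_adams_mem`).

Independence is a count. The pairs `(β, k)` correspond to the Lyndon compositions `kβ`, and `e_k(β)`
is homogeneous of the degree of `kβ`. By uniqueness of the factorization into nonincreasing Lyndon
words, there are at most as many monomials of weight `N` in the generators as compositions of `N`.
These monomials span the degree `N` part, which is free on the compositions of `N`, and a surjection
between such modules is injective (`QuasiSym.coeffMap_injective`). -/

theorem cons_le_cons {a b : ℕ} {u v : List ℕ} : a :: u ≤ b :: v ↔ a < b ∨ a = b ∧ u ≤ v := by
  rw [← not_lt, List.cons_lt_cons_iff, ← not_lt]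
  grind

theorem nil_lt {v : List ℕ} (h : v ≠ []) : [] < v := by
  cases v with
  | nil => exact absurd rfl h
  | cons b v => exact List.Lex.nil

theorem nil_le (v : List ℕ) : [] ≤ v := not_lt.1 (List.not_lt_nil v)

theorem append_lt_append_iff {u v w : List ℕ} : u ++ v < u ++ w ↔ v < w := by
  induction u with
  | nil => rfl
  | cons a u ih => simp [ih]

theorem append_le_append_iff {u v w : List ℕ} : u ++ v ≤ u ++ w ↔ v ≤ w := by
  rw [← not_lt, append_lt_append_iff, not_lt]

theorem le_append (u v : List ℕ) : u ≤ u ++ v := by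
  simpa using append_le_append_iff (u := u).2 (nil_le v)

/-- If `u < v` and `u` is not a prefix of `v`, the comparison is decided at a common position. -/
theorem append_lt_append_of_lt {u v : List ℕ} (h : u < v) (hp : ¬ u <+: v) (x y : List ℕ) :
    u ++ x < v ++ y := by
  induction u generalizing v with
  | nil => exact absurd (List.nil_prefix) hp
  | cons a u ih =>
    cases v with
    | nil => exact absurd h (not_lt.2 (nil_le _))
    | cons b v =>
      rw [List.cons_append, List.cons_append, List.cons_lt_cons_iff]
      rcases List.cons_lt_cons_iff.1 h with h1 | ⟨rfl, h1⟩
      · exact Or.inl h1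
      · exact Or.inr ⟨rfl, ih h1 fun hp' => hp (List.cons_prefix_cons.2 ⟨rfl, hp'⟩)⟩

theorem append_lt_append_of_length_lt {u v : List ℕ} (h : u < v) (hl : v.length < u.length)
    (x y : List ℕ) : u ++ x < v ++ y :=
  append_lt_append_of_lt h (fun hp => absurd hp.length_le (by omega)) x y

/-- A suffix of `u ++ v` is a suffix of `v` or extends `v`. -/
theorem suffix_append_cases {s u v : List ℕ} (h : s <:+ u ++ v) :
    s <:+ v ∨ ∃ t, t <:+ u ∧ t ≠ [] ∧ s = t ++ v := by
  induction u with
  | nil => exact Or.inl h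
  | cons a u ih =>
    rcases List.suffix_cons_iff.1 h with h | h
    · exact Or.inr ⟨a :: u, List.suffix_rfl, by simp, h⟩
    · rcases ih h with h | ⟨t, ht, h⟩
      · exact Or.inl h
      · exact Or.inr ⟨t, ht.trans (List.suffix_cons a u), h⟩

/-- `IsShuffle u v w`: the word `w` is a shuffle of `u` and `v`. -/
inductive IsShuffle : List ℕ → List ℕ → List ℕ → Prop
  | nil : IsShuffle [] [] []
  | left {a u v w} : IsShuffle u v w → IsShuffle (a :: u) v (a :: w)
  | right {a u v w} : IsShuffle u v w → IsShuffle u (a :: v) (a :: w)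

/-- `IsProperShuffle u v w`: the word `w` is a shuffle of `u` and `v` in which some letter of `v`
precedes some letter of `u`. -/
inductive IsProperShuffle : List ℕ → List ℕ → List ℕ → Prop
  | left {a u v w} : IsProperShuffle u v w → IsProperShuffle (a :: u) v (a :: w)
  | right {a u v w} : u ≠ [] → IsShuffle u v w → IsProperShuffle u (a :: v) (a :: w)

namespace IsShuffle

theorem length_eq {u v w : List ℕ} (h : IsShuffle u v w) : w.length = u.length + v.length := by
  induction h with
  | nil => rfl
  | left _ ih => simp [ih]; omega
  | right _ ih => simp [ih]; omega

theorem nil_left (v : List ℕ) : IsShuffle [] v v := by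
  induction v with
  | nil => exact nil
  | cons a v ih => exact ih.right

theorem append (u v : List ℕ) : IsShuffle u v (u ++ v) := by
  induction u with
  | nil => exact nil_left v
  | cons a u ih => exact ih.left

theorem eq_of_nil_left {u v w : List ℕ} (h : IsShuffle u v w) (hu : u = []) : w = v := by
  induction h with
  | nil => rfl
  | left _ _ => simp at hu
  | right _ ih => rw [ih hu]

theorem eq_append_or_isProperShuffle {u v w : List ℕ} (h : IsShuffle u v w) :
    w = u ++ v ∨ IsProperShuffle u v w := by
  induction h with
  | nil => exact Or.inl rfl
  | left _ ih =>
    rcases ih with rfl | ih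
    · exact Or.inl rfl
    · exact Or.inr ih.left
  | @right a u v w h _ =>
    by_cases hu : u = []
    · subst hu
      rw [h.eq_of_nil_left rfl]
      exact Or.inl rfl
    · exact Or.inr (.right hu h)

end IsShuffle

namespace IsProperShuffle

theorem isShuffle {u v w : List ℕ} (h : IsProperShuffle u v w) : IsShuffle u v w := by
  induction h with
  | left _ ih => exact ih.left
  | right _ h => exact h.right

theorem ne_nil {u v w : List ℕ} (h : IsProperShuffle u v w) : u ≠ [] ∧ v ≠ [] := by
  induction h with
  | left _ ih => exact ⟨by simp, ih.2⟩
  | right hu _ => exact ⟨hu, by simp⟩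

theorem exists_of_ne_nil {u v : List ℕ} (hu : u ≠ []) (hv : v ≠ []) : ∃ w, IsProperShuffle u v w := by
  cases v with
  | nil => exact absurd rfl hv
  | cons a v => exact ⟨_, .right hu (.append u v)⟩

end IsProperShuffle

/-- Shuffles are monotone in both words, for words of fixed lengths. -/
theorem IsShuffle.exists_le {u v w u' v' : List ℕ} (h : IsShuffle u v w)
    (hu : u.length = u'.length) (hv : v.length = v'.length) (huu : u ≤ u') (hvv : v ≤ v') :
    ∃ w', IsShuffle u' v' w' ∧ w ≤ w' := by
  induction h generalizing u' v' with
  | nil =>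
    obtain rfl := List.eq_nil_of_length_eq_zero hu.symm
    obtain rfl := List.eq_nil_of_length_eq_zero hv.symm
    exact ⟨_, .nil, le_rfl⟩
  | @left a u v w h ih =>
    cases u' with
    | nil => simp at hu
    | cons b u' =>
      rcases cons_le_cons.1 huu with hab | ⟨rfl, hle⟩
      -- The first letter already increases, so any shuffle of the remaining letters will do.
      · exact ⟨_, (IsShuffle.append u' v').left, cons_le_cons.2 (Or.inl hab)⟩
      · obtain ⟨w', h1, h2⟩ := ih (by simpa using hu) hv hle hvv
        exact ⟨_, h1.left, cons_le_cons.2 (Or.inr ⟨rfl, h2⟩)⟩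
  | @right a u v w h ih =>
    cases v' with
    | nil => simp at hv
    | cons b v' =>
      rcases cons_le_cons.1 hvv with hab | ⟨rfl, hle⟩
      · exact ⟨_, (IsShuffle.append u' v').right, cons_le_cons.2 (Or.inl hab)⟩
      · obtain ⟨w', h1, h2⟩ := ih hu (by simpa using hv) huu hle
        exact ⟨_, h1.right, cons_le_cons.2 (Or.inr ⟨rfl, h2⟩)⟩

theorem IsProperShuffle.exists_le {u v w u' v' : List ℕ} (h : IsProperShuffle u v w)
    (hu : u.length = u'.length) (hv : v.length = v'.length) (huu : u ≤ u') (hvv : v ≤ v') :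
    ∃ w', IsProperShuffle u' v' w' ∧ w ≤ w' := by
  induction h generalizing u' v' with
  | @left a u v w h ih =>
    cases u' with
    | nil => simp at hu
    | cons b u' =>
      have hl : u.length = u'.length := by simpa using hu
      rcases cons_le_cons.1 huu with hab | ⟨rfl, hle⟩
      · have hne := h.ne_nil
        rw [← List.length_pos_iff, ← List.length_pos_iff, hl, hv, List.length_pos_iff,
          List.length_pos_iff] at hne
        obtain ⟨w', hw'⟩ := IsProperShuffle.exists_of_ne_nil hne.1 hne.2
        exact ⟨_, hw'.left, cons_le_cons.2 (Or.inl hab)⟩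
      · obtain ⟨w', h1, h2⟩ := ih hl hv hle hvv
        exact ⟨_, h1.left, cons_le_cons.2 (Or.inr ⟨rfl, h2⟩)⟩
  | @right a u v w hne h =>
    have hne' : u' ≠ [] := by
      rw [← List.length_pos_iff, ← hu, List.length_pos_iff]
      exact hne
    cases v' with
    | nil => simp at hv
    | cons b v' =>
      rcases cons_le_cons.1 hvv with hab | ⟨rfl, hle⟩
      · exact ⟨_, .right hne' (.append u' v'), cons_le_cons.2 (Or.inl hab)⟩
      · obtain ⟨w', h1, h2⟩ := h.exists_le hu (by simpa using hv) huu hle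
        exact ⟨_, .right hne' h1, cons_le_cons.2 (Or.inr ⟨rfl, h2⟩)⟩

/-- Moving a prefix `z` from the larger of two words to the smaller one makes room for a larger
shuffle. -/
theorem IsShuffle.exists_le_of_lt {y z u v : List ℕ} (h : IsShuffle (z ++ u) v y) (hvu : v < u)
    (hz : z ≠ []) : ∃ y', (IsProperShuffle u (z ++ v) y' ∧ y ≤ y') ∨
      (IsShuffle u (z ++ v) y' ∧ y < y') := by
  induction y generalizing z u v with
  | nil =>
    have := h.length_eq
    cases z with
    | nil => exact absurd rfl hz
    | cons c z => simp at this; omega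
  | cons a y ih =>
    cases z with
    | nil => exact absurd rfl hz
    | cons c z =>
      cases u with
      | nil => exact absurd hvu (not_lt.2 (nil_le _))
      | cons d u =>
        cases h with
        | left h =>
          by_cases hz' : z = []
          · subst hz'
            -- The word itself works: its first letter now counts as a letter of the second word,
            -- and it precedes the nonempty `u`.
            exact ⟨_, Or.inl ⟨.right (by simp) h, le_rfl⟩⟩
          · obtain ⟨y', h' | h'⟩ := ih h hvu hz'
            · exact ⟨_, Or.inl ⟨.right (by simp) h'.1.isShuffle, cons_le_cons.2 (Or.inr ⟨rfl, h'.2⟩)⟩⟩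
            · exact ⟨_, Or.inr ⟨h'.1.right, List.cons_lt_cons_iff.2 (Or.inr ⟨rfl, h'.2⟩)⟩⟩
        | @right _ _ v _ h =>
          rcases List.cons_lt_cons_iff.1 hvu with had | ⟨rfl, hlt⟩
          · exact ⟨_, Or.inr ⟨(IsShuffle.append u (c :: z ++ a :: v)).left,
              List.cons_lt_cons_iff.2 (Or.inl had)⟩⟩
          -- Both words begin with `a`. The letter read is now charged to `u` instead of `v`, and
          -- the other copy of `a` joins the prefix that is to be moved.
          · have h2 : IsShuffle ((c :: z ++ [a]) ++ u) v y := by simpa using h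
            obtain ⟨y', h' | h'⟩ := ih h2 hlt (by simp)
            · refine ⟨a :: y', Or.inl ⟨.left ?_, cons_le_cons.2 (Or.inr ⟨rfl, h'.2⟩)⟩⟩
              simpa using h'.1
            · refine ⟨a :: y', Or.inr ⟨.left ?_, List.cons_lt_cons_iff.2 (Or.inr ⟨rfl, h'.2⟩)⟩⟩
              simpa using h'.1

/-- If all nonempty suffixes of `v` are larger than `m`, then `v ++ m` is larger than all other
shuffles of `v` and `m`. -/
theorem IsProperShuffle.lt_append {v m y : List ℕ} (h : IsProperShuffle v m y)
    (hv : ∀ s, s <:+ v → s ≠ [] → m < s) : y < v ++ m := by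
  induction v generalizing m y with
  | nil => exact absurd rfl h.ne_nil.1
  | cons b v ih =>
    have hv' : ∀ s, s <:+ v → s ≠ [] → m < s := fun s hs => hv s (hs.trans (List.suffix_cons b v))
    cases h with
    | left h => exact List.cons_lt_cons_iff.2 (Or.inr ⟨rfl, ih h hv'⟩)
    | @right a _ m y hne h =>
      rw [List.cons_append, List.cons_lt_cons_iff]
      rcases List.cons_lt_cons_iff.1 (hv _ List.suffix_rfl hne) with hab | ⟨rfl, hlt⟩
      · exact Or.inl hab
      · refine Or.inr ⟨rfl, ?_⟩
        -- Here `y` shuffles `a :: v` with `m`. Moving `a` across gives a shuffle of `v` with the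
        -- whole second word `a :: m`, to which the induction hypothesis applies.
        obtain ⟨y', h' | h'⟩ := IsShuffle.exists_le_of_lt (z := [a]) (u := v) h hlt (by simp)
        · exact h'.2.trans_lt (ih h'.1 hv')
        · rcases h'.1.eq_append_or_isProperShuffle with rfl | hp
          · exact h'.2
          · exact h'.2.trans (ih hp hv')

theorem IsShuffle.le_append {v m y : List ℕ} (h : IsShuffle v m y)
    (hv : ∀ s, s <:+ v → s ≠ [] → m < s) : y ≤ v ++ m := by
  rcases h.eq_append_or_isProperShuffle with rfl | hp
  · exact le_rfl
  · exact (hp.lt_append hv).le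

end Word

/-! ### Powers of Lyndon words and minimal suffixes -/

namespace Word

/-- The `n`-fold concatenation of a word with itself. -/
def pow (l : List ℕ) (n : ℕ) : List ℕ := (List.replicate n l).flatten

theorem pow_zero (l : List ℕ) : pow l 0 = [] := rfl

theorem pow_succ (l : List ℕ) (n : ℕ) : pow l (n + 1) = l ++ pow l n := by
  simp [pow, List.replicate_succ]

theorem length_pow (l : List ℕ) (n : ℕ) : (pow l n).length = n * l.length := by
  simp [pow]

end Word

theorem IsLyndonWord.lt_of_suffix {l s : List ℕ} (hl : IsLyndonWord l) (hs : s <:+ l)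
    (hne : s ≠ []) (hsl : s ≠ l) : l < s := by
  obtain ⟨t, rfl⟩ := hs
  refine hl.2 t s rfl ?_ hne
  rintro rfl
  exact hsl rfl

theorem IsLyndonWord.le_of_suffix {l s : List ℕ} (hl : IsLyndonWord l) (hs : s <:+ l)
    (hne : s ≠ []) : l ≤ s := by
  by_cases h : s = l
  · exact h.ge
  · exact (hl.lt_of_suffix hs hne h).le

namespace Word

/-- Proper suffixes of a Lyndon word are larger than all words that begin with it. -/
theorem append_lt_of_suffix {l s : List ℕ} (hl : IsLyndonWord l) (hs : s <:+ l)
    (hne : s ≠ []) (hsl : s ≠ l) (x y : List ℕ) : l ++ x < s ++ y :=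
  append_lt_append_of_length_lt (hl.lt_of_suffix hs hne hsl)
    (lt_of_le_of_ne hs.length_le fun h => hsl (hs.eq_of_length h)) x y

theorem pow_lt_of_suffix {l s : List ℕ} (hl : IsLyndonWord l) (hs : s <:+ l)
    (hne : s ≠ []) (hsl : s ≠ l) (n : ℕ) : pow l n < s := by
  cases n with
  | zero => exact nil_lt hne
  | succ n =>
    rw [pow_succ]
    simpa using append_lt_of_suffix hl hs hne hsl (pow l n) []

/-- If `l` is a minimal suffix of `v ++ l ^ n`, and `v` does not end in `l`, then all suffixes
of `v` are larger than the powers of `l`. -/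
theorem pow_lt_of_suffix_append {l v : List ℕ} (hl : IsLyndonWord l) {n : ℕ} (hn : 0 < n)
    (hmin : ∀ s, s <:+ v ++ pow l n → s ≠ [] → l ≤ s) (hv : ¬ l <:+ v) {s : List ℕ}
    (hs : s <:+ v) (hne : s ≠ []) (j : ℕ) : pow l j < s := by
  induction j generalizing s with
  | zero => exact nil_lt hne
  | succ j ih =>
    obtain ⟨n, rfl⟩ := Nat.exists_eq_succ_of_ne_zero hn.ne'
    rw [pow_succ]
    have h : l ≤ s ++ pow l (n + 1) := hmin _ (List.suffix_append_self_iff.2 hs) (by simp [hne])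
    by_cases hp : l <+: s
    · obtain ⟨t, rfl⟩ := hp
      have ht : t ≠ [] := by
        rintro rfl
        exact hv (by simpa using hs)
      exact append_lt_append_iff.2 (ih ((List.suffix_append l t).trans hs) ht)
    · have hls : l < s := by
        by_contra hlt
        rw [not_lt] at hlt
        have hlt : s < l := lt_of_le_of_ne hlt fun e => hp (e ▸ List.prefix_rfl)
        by_cases hp' : s <+: l
        · obtain ⟨t, rfl⟩ := hp'
          have ht : t ≠ [] := by
            rintro rfl
            simp at hlt
          -- Cancelling `s` leaves `t ≤ pow (s ++ t) (n + 1)`, but a proper suffix `t` of a Lyndon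
          -- word exceeds every word that begins with the Lyndon word.
          refine absurd (append_le_append_iff.1 h) (not_le.2 ?_)
          rw [pow_succ]
          simpa using append_lt_of_suffix hl (List.suffix_append s t) ht (by simpa using hne)
            (pow (s ++ t) n) []
        · exact absurd h (not_le.2 (by simpa using append_lt_append_of_lt hlt hp' _ []))
      simpa using append_lt_append_of_lt hls hp (pow l j) []

/-! ### The shuffle product of integral functions on words -/

/-- The shuffle product of two functions on words. -/
def shuffle : (List ℕ → ℤ) → (List ℕ → ℤ) → List ℕ → ℤ
  | F, G, [] => F [] * G []
  | F, G, a :: w => shuffle (fun u => F (a :: u)) G w + shuffle F (fun u => G (a :: u)) w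

theorem shuffle_nil (F G : List ℕ → ℤ) : shuffle F G [] = F [] * G [] := rfl

theorem shuffle_cons (F G : List ℕ → ℤ) (a : ℕ) (w : List ℕ) : shuffle F G (a :: w) =
    shuffle (fun u => F (a :: u)) G w + shuffle F (fun u => G (a :: u)) w := rfl

theorem shuffle_cons_fun (F G : List ℕ → ℤ) (a : ℕ) : (fun w => shuffle F G (a :: w)) =
    shuffle (fun u => F (a :: u)) G + shuffle F (fun u => G (a :: u)) := rfl

theorem shuffle_add (F G H : List ℕ → ℤ) : shuffle F (G + H) = shuffle F G + shuffle F H := by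
  funext w
  induction w generalizing F G H with
  | nil => simp only [shuffle_nil, Pi.add_apply]; ring
  | cons a w ih =>
    have e : (fun u => (G + H) (a :: u)) = (fun u => G (a :: u)) + fun u => H (a :: u) := rfl
    rw [shuffle_cons, e, ih, ih]
    simp only [shuffle_cons, Pi.add_apply]
    ring

theorem shuffle_smul (F G : List ℕ → ℤ) (c : ℤ) : shuffle F (c • G) = c • shuffle F G := by
  funext w
  induction w generalizing F G with
  | nil => simp only [shuffle_nil, Pi.smul_apply, smul_eq_mul]; ring
  | cons a w ih =>
    have e : (fun u => (c • G) (a :: u)) = c • fun u => G (a :: u) := rfl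
    rw [shuffle_cons, e, ih, ih]
    simp only [shuffle_cons, Pi.smul_apply, smul_eq_mul]
    ring

theorem shuffle_zero (F : List ℕ → ℤ) : shuffle F 0 = 0 := by
  simpa using shuffle_smul F 0 0

/-- Stands in for commutativity and associativity together, in the form that the divided powers
need. Removing a given first letter is a derivation of the shuffle product, which drives the
induction. -/
theorem shuffle_left_comm (F G H : List ℕ → ℤ) :
    shuffle F (shuffle G H) = shuffle G (shuffle F H) := by
  funext w
  induction w generalizing F G H with
  | nil => simp only [shuffle_nil]; ring
  | cons a w ih =>
    rw [shuffle_cons, shuffle_cons, shuffle_cons_fun, shuffle_cons_fun, shuffle_add, shuffle_add,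
      Pi.add_apply, Pi.add_apply, ih (fun u => F (a :: u)) G, ih F (fun u => G (a :: u)), ih F G]
    ring

/-- A nonzero coefficient of a shuffle product comes from a shuffle of words. -/
theorem exists_isShuffle {F G : List ℕ → ℤ} {w : List ℕ} (h : shuffle F G w ≠ 0) :
    ∃ u v, IsShuffle u v w ∧ F u ≠ 0 ∧ G v ≠ 0 := by
  induction w generalizing F G with
  | nil =>
    rw [shuffle_nil] at h
    exact ⟨[], [], .nil, left_ne_zero_of_mul h, right_ne_zero_of_mul h⟩
  | cons a w ih =>
    rw [shuffle_cons] at h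
    by_cases h1 : shuffle (fun u => F (a :: u)) G w = 0
    · rw [h1, zero_add] at h
      obtain ⟨u, v, hw, hu, hv⟩ := ih h
      exact ⟨u, a :: v, hw.right, hu, hv⟩
    · obtain ⟨u, v, hw, hu, hv⟩ := ih h1
      exact ⟨a :: u, v, hw.left, hu, hv⟩

/-- The function `F` is supported on words of the length of `α`, its largest word is `α`, and `α`
has coefficient `1`. -/
def Leads (α : List ℕ) (F : List ℕ → ℤ) : Prop :=
  F α = 1 ∧ ∀ w, F w ≠ 0 → w.length = α.length ∧ w ≤ α

theorem Leads.tail {α : List ℕ} {a : ℕ} {F : List ℕ → ℤ} (h : Leads (a :: α) F) :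
    Leads α (fun u => F (a :: u)) := by
  refine ⟨h.1, fun w hw => ?_⟩
  obtain ⟨h1, h2⟩ := h.2 _ hw
  refine ⟨by simpa using h1, ?_⟩
  rcases cons_le_cons.1 h2 with h2 | h2
  · exact absurd h2 (lt_irrefl _)
  · exact h2.2

theorem leads_single (α : List ℕ) : Leads α (Pi.single α 1) := by
  refine ⟨Pi.single_eq_same _ _, fun w hw => ?_⟩
  have : w = α := by
    by_contra hne
    exact hw (Pi.single_eq_of_ne hne _)
  exact ⟨this ▸ rfl, this.le⟩

/-- The word `α ++ β` arises only by reading all of `α` first: any other way to obtain it would be a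
proper shuffle of words bounded by `α` and `β`, hence smaller than `α ++ β`. -/
theorem Leads.shuffle_apply_append {α β : List ℕ} {F G : List ℕ → ℤ} (hF : Leads α F)
    (hG : Leads β G) (h : ∀ s, s <:+ α → s ≠ [] → β < s) : shuffle F G (α ++ β) = 1 := by
  induction α generalizing F with
  | nil =>
    have hF0 : ∀ (w : List ℕ) (G : List ℕ → ℤ), shuffle F G w = G w := by
      intro w
      induction w with
      | nil => intro G; rw [shuffle_nil, hF.1, one_mul]
      | cons a w ih =>
        intro G
        rw [shuffle_cons, ih, add_eq_right]
        by_contra hne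
        obtain ⟨u, v, _, hu, _⟩ := exists_isShuffle hne
        simpa using (hF.2 _ hu).1
    rw [hF0]
    exact hG.1
  | cons a α ih =>
    rw [List.cons_append, shuffle_cons,
      ih hF.tail fun s hs => h s (hs.trans (List.suffix_cons a α)), add_eq_left]
    by_contra hne
    obtain ⟨u, v, hw, hu, hv⟩ := exists_isShuffle hne
    obtain ⟨hu1, hu2⟩ := hF.2 _ hu
    obtain ⟨hv1, hv2⟩ := hG.2 _ hv
    have hu0 : u ≠ [] := by
      rintro rfl
      simp at hu1
    obtain ⟨y, hy, hle⟩ := (IsProperShuffle.right (a := a) hu0 hw).exists_le hu1 hv1 hu2 hv2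
    exact absurd hle (not_le.2 (hy.lt_append h))

/-- Leading words are concatenated in a shuffle product, under a condition on their order. -/
theorem Leads.shuffle {α β : List ℕ} {F G : List ℕ → ℤ} (hF : Leads α F)
    (hG : Leads β G) (h : ∀ s, s <:+ α → s ≠ [] → β < s) : Leads (α ++ β) (shuffle F G) := by
  refine ⟨hF.shuffle_apply_append hG h, fun w hw => ?_⟩
  obtain ⟨u, v, hw, hu, hv⟩ := exists_isShuffle hw
  obtain ⟨hu1, hu2⟩ := hF.2 _ hu
  obtain ⟨hv1, hv2⟩ := hG.2 _ hv
  obtain ⟨y, hy, hle⟩ := hw.exists_le hu1 hv1 hu2 hv2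
  exact ⟨by rw [hw.length_eq, hu1, hv1, List.length_append], hle.trans (hy.le_append h)⟩

/-- Divided powers of a Lyndon word lead with the powers of the word. -/
theorem leads_pow {l : List ℕ} (hl : IsLyndonWord l) {E : ℕ → List ℕ → ℤ}
    (h0 : E 0 = Pi.single [] 1)
    (hE : ∀ n : ℕ, ((n + 1 : ℕ) : ℤ) • E (n + 1) = shuffle (Pi.single l 1) (E n)) (n : ℕ) :
    Leads (pow l n) (E n) := by
  -- The rule `∂(l ^ (n+1) / (n+1)!) = ∂l * l ^ n / n!` for the derivation that removes a first
  -- letter `a`. It determines `E (n + 1)` on nonempty words without any division.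
  have hD : ∀ (a n : ℕ), (fun w => E (n + 1) (a :: w)) =
      shuffle (fun w => (Pi.single l 1 : List ℕ → ℤ) (a :: w)) (E n) := by
    intro a n
    have hD1 : ∀ n : ℕ, ((n + 1 : ℕ) : ℤ) • (fun w => E (n + 1) (a :: w)) =
        shuffle (fun w => (Pi.single l 1 : List ℕ → ℤ) (a :: w)) (E n) +
          shuffle (Pi.single l 1) (fun w => E n (a :: w)) := by
      intro n
      rw [← shuffle_cons_fun, ← hE]
      rfl
    have hinj : ∀ (n : ℕ) (F G : List ℕ → ℤ), ((n + 1 : ℕ) : ℤ) • F = ((n + 1 : ℕ) : ℤ) • G →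
        F = G := fun n F G h => smul_right_injective _ (by positivity) h
    induction n with
    | zero =>
      refine hinj 0 _ _ ?_
      rw [hD1, h0]
      have : (fun w => (Pi.single [] 1 : List ℕ → ℤ) (a :: w)) = 0 := by
        funext w
        exact Pi.single_eq_of_ne (by simp) _
      rw [this, shuffle_zero]
      simp
    | succ n ih =>
      refine hinj (n + 1) _ _ ?_
      rw [hD1, ih, shuffle_left_comm, ← hE, shuffle_smul]
      push_cast
      module
  induction n with
  | zero => rw [h0, pow_zero]; exact leads_single _
  | succ n ih =>
    cases l with
    | nil => exact absurd rfl hl.1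
    | cons b l =>
      have hb : (fun w => (Pi.single (b :: l) 1 : List ℕ → ℤ) (b :: w)) = Pi.single l 1 := by
        funext w
        simp [Pi.single_apply]
      have hlead : Leads (l ++ pow (b :: l) n) (fun w => E (n + 1) (b :: w)) := by
        rw [hD, hb]
        -- Suffixes of the tail are proper suffixes of the Lyndon word, so they exceed its powers.
        refine (leads_single l).shuffle ih fun s hs hne => ?_
        refine pow_lt_of_suffix hl (hs.trans (List.suffix_cons b l)) hne ?_ n
        rintro rfl
        simpa using hs.length_le
      rw [pow_succ]
      refine ⟨hlead.1, fun w hw => ?_⟩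
      cases w with
      | nil =>
        have := congrFun (hE n) []
        rw [shuffle_nil, Pi.single_eq_of_ne (by simp), zero_mul,
          Pi.smul_apply, smul_eq_mul] at this
        exact absurd ((mul_eq_zero.1 this).resolve_left (by positivity)) hw
      | cons a w =>
        by_cases hab : a = b
        · subst hab
          obtain ⟨h1, h2⟩ := hlead.2 w hw
          exact ⟨by simpa using h1, cons_le_cons.2 (Or.inr ⟨rfl, h2⟩)⟩
        · have h := congrFun (hD a n) w
          have e : (fun w => (Pi.single (b :: l) 1 : List ℕ → ℤ) (a :: w)) = 0 := by
            funext w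
            exact Pi.single_eq_of_ne (by simp [hab]) _
          rw [e] at h
          refine absurd h fun h => hw (h.trans ?_)
          by_contra hne
          obtain ⟨u, v, _, hu, _⟩ := exists_isShuffle hne
          exact hu rfl

end Word

/-! ### Coefficients of quasisymmetric functions at words -/

namespace QuasiSym

open MvPowerSeries Word

/-- The exponent of `x_0 ^ w_0 * x_1 ^ w_1 * ⋯`. -/
noncomputable def expo : List ℕ → ℕ →₀ ℕ
  | [] => 0
  | a :: w => Finsupp.single 0 a + (expo w).mapDomain Nat.succ

theorem expo_ofFn {m : ℕ} (a : Fin m → ℕ) :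
    expo (List.ofFn a) = ∑ k : Fin m, Finsupp.single (k : ℕ) (a k) := by
  induction m with
  | zero => simp [expo]
  | succ m ih =>
    rw [List.ofFn_succ, expo, ih, Fin.sum_univ_succ, Finsupp.mapDomain_finsetSum]
    simp [Finsupp.mapDomain_single]

theorem coeff_eq_coeff_expo {f : MvPowerSeries ℕ ℤ} (hf : f ∈ QSymm) {m : ℕ} (a : Fin m → ℕ)
    {i : Fin m → ℕ} (hi : StrictMono i) :
    coeff (∑ k, Finsupp.single (i k) (a k)) f = coeff (expo (List.ofFn a)) f := by
  rw [expo_ofFn]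
  exact IsQuasisymmetric.coeff_eq hf a hi Fin.val_strictMono

/-- The nonzero exponents of a monomial, in increasing order of the variables. -/
noncomputable def word (s : ℕ →₀ ℕ) : List ℕ := (s.support.sort (· ≤ ·)).map s

theorem sum_single_apply {m : ℕ} (a : Fin m → ℕ) {i : Fin m → ℕ} (hi : StrictMono i) (k : Fin m) :
    (∑ k, Finsupp.single (i k) (a k)) (i k) = a k := by
  rw [Finsupp.finsetSum_apply, Finset.sum_eq_single k]
  · simp
  · intro l _ hl
    exact Finsupp.single_eq_of_ne (fun h => hl (hi.injective h.symm))
  · simp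

theorem word_sum_single {m : ℕ} {a : Fin m → ℕ} (ha : ∀ k, 0 < a k) {i : Fin m → ℕ}
    (hi : StrictMono i) : word (∑ k, Finsupp.single (i k) (a k)) = List.ofFn a := by
  have hs : (∑ k, Finsupp.single (i k) (a k)).support = (List.ofFn i).toFinset := by
    ext x
    rw [List.mem_toFinset, List.mem_ofFn, Finsupp.mem_support_iff]
    constructor
    · intro h
      by_contra hx
      refine h ?_
      rw [Finsupp.finsetSum_apply]
      exact Finset.sum_eq_zero fun l _ => Finsupp.single_eq_of_ne (fun h => hx ⟨l, h.symm⟩)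
    · rintro ⟨k, rfl⟩
      rw [sum_single_apply a hi]
      exact (ha k).ne'
  have hsort : (List.ofFn i).toFinset.sort (· ≤ ·) = List.ofFn i := by
    refine (List.toFinset_sort (· ≤ ·) (List.nodup_ofFn.2 hi.injective)).2 ?_
    exact (List.sortedLE_ofFn_iff.2 hi.monotone).pairwise
  rw [word, hs, hsort, List.map_ofFn]
  congr 1
  funext k
  exact sum_single_apply a hi k

theorem exists_eq_sum_single (s : ℕ →₀ ℕ) : ∃ (m : ℕ) (a i : Fin m → ℕ), (∀ k, 0 < a k) ∧
    StrictMono i ∧ s = ∑ k, Finsupp.single (i k) (a k) := by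
  let e := s.support.orderIsoOfFin rfl
  refine ⟨_, fun k => s (e k), fun k => e k, fun k => ?_, fun x y h => e.strictMono h, ?_⟩
  · exact Nat.pos_of_ne_zero (Finsupp.mem_support_iff.1 (e k).2)
  · have h := e.toEquiv.sum_comp (fun x : s.support => Finsupp.single (x : ℕ) (s x))
    rw [Finset.sum_coe_sort s.support (fun x => Finsupp.single x (s x))] at h
    exact (Finsupp.sum_single s).symm.trans h.symm

theorem zero_notMem_ofFn {m : ℕ} {a : Fin m → ℕ} (ha : ∀ k, 0 < a k) : 0 ∉ List.ofFn a := by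
  rw [List.mem_ofFn]
  rintro ⟨k, hk⟩
  exact (ha k).ne' hk

theorem zero_notMem_word (s : ℕ →₀ ℕ) : 0 ∉ word s := by
  obtain ⟨m, a, i, ha, hi, rfl⟩ := exists_eq_sum_single s
  rw [word_sum_single ha hi]
  exact zero_notMem_ofFn ha

theorem sum_word (s : ℕ →₀ ℕ) : (word s).sum = s.degree := by
  obtain ⟨m, a, i, ha, hi, rfl⟩ := exists_eq_sum_single s
  rw [word_sum_single ha hi, map_sum, List.sum_ofFn]
  simp

theorem word_expo {w : List ℕ} (hw : 0 ∉ w) : word (expo w) = w := by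
  obtain ⟨m, a, rfl⟩ : ∃ (m : ℕ) (a : Fin m → ℕ), w = List.ofFn a := ⟨_, w.get, by simp⟩
  rw [expo_ofFn]
  refine word_sum_single (fun k => Nat.pos_of_ne_zero fun h => hw ?_) Fin.val_strictMono
  exact List.mem_ofFn.2 ⟨k, h⟩

theorem coeff_expo_word {f : MvPowerSeries ℕ ℤ} (hf : f ∈ QSymm) (s : ℕ →₀ ℕ) :
    coeff (expo (word s)) f = coeff s f := by
  obtain ⟨m, a, i, ha, hi, rfl⟩ := exists_eq_sum_single s
  rw [word_sum_single ha hi, coeff_eq_coeff_expo hf a hi]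

theorem coeff_monomialQSymm (α : List ℕ) (s : ℕ →₀ ℕ) :
    coeff s (monomialQSymm α) = if word s = α then 1 else 0 := rfl

theorem monomialQSymm_mem (α : List ℕ) : monomialQSymm α ∈ QSymm := by
  refine ⟨⟨α.sum, fun s hs => ?_⟩, fun m a i j ha hi hj => ?_⟩
  · rw [coeff_monomialQSymm, if_neg]
    rintro rfl
    rw [sum_word] at hs
    exact lt_irrefl _ hs
  · rw [coeff_monomialQSymm, coeff_monomialQSymm, word_sum_single ha hi, word_sum_single ha hj]

/-- The coefficient of `x_0 ^ a` in a power series, as a power series in the remaining variables,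
which are renumbered. -/
noncomputable def slice (a : ℕ) (f : MvPowerSeries ℕ ℤ) : MvPowerSeries ℕ ℤ :=
  fun s => coeff (Finsupp.single 0 a + s.mapDomain Nat.succ) f

theorem coeff_slice (a : ℕ) (f : MvPowerSeries ℕ ℤ) (s : ℕ →₀ ℕ) :
    coeff s (slice a f) = coeff (Finsupp.single 0 a + s.mapDomain Nat.succ) f := rfl

theorem single_add_mapDomain_succ_zero (a : ℕ) (s : ℕ →₀ ℕ) :
    (Finsupp.single 0 a + s.mapDomain Nat.succ : ℕ →₀ ℕ) 0 = a := by
  rw [Finsupp.add_apply, Finsupp.single_eq_same, Finsupp.mapDomain_of_notMem_range _ _ (by simp),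
    add_zero]

theorem single_add_mapDomain_succ_succ (a : ℕ) (s : ℕ →₀ ℕ) (n : ℕ) :
    (Finsupp.single 0 a + s.mapDomain Nat.succ : ℕ →₀ ℕ) (n + 1) = s n := by
  rw [Finsupp.add_apply, Finsupp.single_eq_of_ne (by simp), zero_add]
  exact Finsupp.mapDomain_apply Nat.succ_injective s n

/-- The exponent of `x_0` in a product splits between the factors. Read on words, this is the
quasi-shuffle recursion: for `a > 0` the first letter `a` comes from one factor alone, or is the sum
of a first letter of each. -/
theorem slice_mul (a : ℕ) (f g : MvPowerSeries ℕ ℤ) : slice a (f * g) =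
    ∑ p ∈ Finset.HasAntidiagonal.antidiagonal a, slice p.1 f * slice p.2 g := by
  let tl : (ℕ →₀ ℕ) → ℕ →₀ ℕ := fun t => t.comapDomain Nat.succ Nat.succ_injective.injOn
  have htl : ∀ t : ℕ →₀ ℕ, Finsupp.single 0 (t 0) + (tl t).mapDomain Nat.succ = t := by
    intro t
    ext n
    cases n with
    | zero => exact single_add_mapDomain_succ_zero _ _
    | succ n => exact single_add_mapDomain_succ_succ _ _ n
  have htl' : ∀ (a : ℕ) (s : ℕ →₀ ℕ), tl (Finsupp.single 0 a + s.mapDomain Nat.succ) = s := by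
    intro a s
    ext n
    exact single_add_mapDomain_succ_succ _ _ n
  ext s
  rw [coeff_slice, coeff_mul, map_sum]
  simp_rw [coeff_mul]
  rw [← Finset.sum_product']
  refine Finset.sum_bij' (fun p _ => ((p.1 0, p.2 0), (tl p.1, tl p.2)))
    (fun q _ => (Finsupp.single 0 q.1.1 + q.2.1.mapDomain Nat.succ,
      Finsupp.single 0 q.1.2 + q.2.2.mapDomain Nat.succ)) ?_ ?_ ?_ ?_ ?_
  · intro p hp
    rw [Finset.HasAntidiagonal.mem_antidiagonal] at hp
    rw [Finset.mem_product, Finset.HasAntidiagonal.mem_antidiagonal,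
      Finset.HasAntidiagonal.mem_antidiagonal]
    refine ⟨?_, ?_⟩
    · rw [← single_add_mapDomain_succ_zero a s, ← hp, Finsupp.add_apply]
    · ext n
      rw [← single_add_mapDomain_succ_succ a s n, ← hp, Finsupp.add_apply]
      rfl
  · intro q hq
    rw [Finset.mem_product, Finset.HasAntidiagonal.mem_antidiagonal,
      Finset.HasAntidiagonal.mem_antidiagonal] at hq
    rw [Finset.HasAntidiagonal.mem_antidiagonal, ← hq.1, ← hq.2, Finsupp.single_add,
      Finsupp.mapDomain_add]
    exact add_add_add_comm _ _ _ _
  · intro p _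
    exact Prod.ext (htl p.1) (htl p.2)
  · intro q _
    refine Prod.ext (Prod.ext ?_ ?_) (Prod.ext (htl' _ _) (htl' _ _))
    · exact single_add_mapDomain_succ_zero _ _
    · exact single_add_mapDomain_succ_zero _ _
  · intro p _
    rw [coeff_slice, coeff_slice, htl, htl]

theorem coeff_sum_single_slice (a : ℕ) (f : MvPowerSeries ℕ ℤ) {m : ℕ} (b i : Fin m → ℕ) :
    coeff (∑ k, Finsupp.single (i k) (b k)) (slice a f) =
      coeff (∑ k, Finsupp.single ((Fin.cons 0 (fun k => i k + 1) : Fin (m + 1) → ℕ) k)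
        ((Fin.cons a b : Fin (m + 1) → ℕ) k)) f := by
  rw [coeff_slice, Fin.sum_univ_succ, Finsupp.mapDomain_finsetSum]
  simp [Finsupp.mapDomain_single]

theorem strictMono_cons {m : ℕ} {i : Fin m → ℕ} (hi : StrictMono i) :
    StrictMono (Fin.cons 0 (fun k => i k + 1) : Fin (m + 1) → ℕ) := by
  intro x y h
  cases y using Fin.cases with
  | zero => exact absurd h (Fin.not_lt_zero x)
  | succ y =>
    cases x using Fin.cases with
    | zero => simp
    | succ x => simpa using hi (Fin.succ_lt_succ_iff.1 h)

theorem slice_mem (a : ℕ) {f : MvPowerSeries ℕ ℤ} (hf : f ∈ QSymm) : slice a f ∈ QSymm := by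
  refine ⟨?_, fun m b i j _ hi hj => ?_⟩
  · obtain ⟨d, hd⟩ := hf.1
    refine ⟨d, fun s hs => hd _ ?_⟩
    rw [map_add, Finsupp.degree_mapDomain]
    omega
  · rw [coeff_sum_single_slice, coeff_sum_single_slice]
    exact IsQuasisymmetric.coeff_eq hf _ (strictMono_cons hi) (strictMono_cons hj)

/-- Quasisymmetry is invariance under shifting the variables past an unused one. In `slice_mul` this
leaves untouched the factor that contributes no letter. -/
theorem slice_zero {f : MvPowerSeries ℕ ℤ} (hf : f ∈ QSymm) : slice 0 f = f := by
  ext s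
  obtain ⟨m, a, i, _, hi, rfl⟩ := exists_eq_sum_single s
  rw [coeff_slice, Finsupp.single_zero, zero_add, Finsupp.mapDomain_finsetSum]
  simp only [Finsupp.mapDomain_single]
  exact IsQuasisymmetric.coeff_eq hf a (fun x y h => Nat.succ_lt_succ (hi h)) hi

/-- The coefficient at a word of positive integers; it is set to `0` for other words. -/
noncomputable def wcoeff (w : List ℕ) : MvPowerSeries ℕ ℤ →+ ℤ :=
  if 0 ∈ w then 0 else (coeff (expo w)).toAddMonoidHom

theorem wcoeff_of_mem {w : List ℕ} (hw : 0 ∈ w) (f : MvPowerSeries ℕ ℤ) : wcoeff w f = 0 := by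
  rw [wcoeff, if_pos hw, AddMonoidHom.zero_apply]

theorem wcoeff_of_notMem {w : List ℕ} (hw : 0 ∉ w) (f : MvPowerSeries ℕ ℤ) :
    wcoeff w f = coeff (expo w) f := by
  rw [wcoeff, if_neg hw]
  rfl

theorem wcoeff_nil (f : MvPowerSeries ℕ ℤ) : wcoeff [] f = coeff 0 f :=
  wcoeff_of_notMem (by simp) f

theorem wcoeff_cons {a : ℕ} (ha : 0 < a) (w : List ℕ) (f : MvPowerSeries ℕ ℤ) :
    wcoeff (a :: w) f = wcoeff w (slice a f) := by
  by_cases hw : 0 ∈ w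
  · rw [wcoeff_of_mem hw, wcoeff_of_mem (by simp [hw])]
  · rw [wcoeff_of_notMem hw, wcoeff_of_notMem (by simp [hw, ha.ne]), coeff_slice, expo]

theorem wcoeff_zero_cons (w : List ℕ) (f : MvPowerSeries ℕ ℤ) : wcoeff (0 :: w) f = 0 :=
  wcoeff_of_mem (by simp) f

theorem ext_wcoeff {f g : MvPowerSeries ℕ ℤ} (hf : f ∈ QSymm) (hg : g ∈ QSymm)
    (h : ∀ w, 0 ∉ w → wcoeff w f = wcoeff w g) : f = g := by
  ext s
  have hw := h (word s) (zero_notMem_word s)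
  rwa [wcoeff_of_notMem (zero_notMem_word s), wcoeff_of_notMem (zero_notMem_word s),
    coeff_expo_word hf, coeff_expo_word hg] at hw

theorem wcoeff_monomialQSymm {α : List ℕ} (hα : 0 ∉ α) (w : List ℕ) :
    wcoeff w (monomialQSymm α) = (Pi.single α 1 : List ℕ → ℤ) w := by
  by_cases hw : 0 ∈ w
  · rw [wcoeff_of_mem hw, Pi.single_eq_of_ne]
    rintro rfl
    exact hα hw
  · rw [wcoeff_of_notMem hw, coeff_monomialQSymm, word_expo hw, Pi.single_apply]

theorem wcoeff_one (w : List ℕ) : wcoeff w 1 = (Pi.single [] 1 : List ℕ → ℤ) w := by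
  have h : (1 : MvPowerSeries ℕ ℤ) = monomialQSymm [] := by
    ext s
    rw [coeff_one, coeff_monomialQSymm]
    by_cases hs : s = 0
    · simp [hs, word]
    · rw [if_neg hs, if_neg]
      intro h
      refine hs ((Finsupp.degree_eq_zero_iff s).1 ?_)
      rw [← sum_word, h, List.sum_nil]
  rw [h, wcoeff_monomialQSymm (by simp)]

theorem wcoeff_eq_zero_of_degree {f : MvPowerSeries ℕ ℤ} {d : ℕ}
    (hf : ∀ s : ℕ →₀ ℕ, coeff s f ≠ 0 → s.degree = d) {w : List ℕ} (hw : wcoeff w f ≠ 0) :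
    0 ∉ w ∧ w.sum = d := by
  by_cases h0 : 0 ∈ w
  · exact absurd (wcoeff_of_mem h0 f) hw
  · rw [wcoeff_of_notMem h0] at hw
    refine ⟨h0, ?_⟩
    rw [← hf _ hw, ← sum_word, word_expo h0]

/-! ### The longest words in a product -/

/-- All words that occur in `f` have length at most `p`. -/
def LengthLE (p : ℤ) (f : MvPowerSeries ℕ ℤ) : Prop :=
  ∀ w : List ℕ, p < w.length → wcoeff w f = 0

/-- The restriction of the coefficient function of `f` to the words of length `p`. -/
noncomputable def top (p : ℤ) (f : MvPowerSeries ℕ ℤ) (w : List ℕ) : ℤ :=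
  if (w.length : ℤ) = p then wcoeff w f else 0

theorem LengthLE.slice {p : ℤ} {f : MvPowerSeries ℕ ℤ} (hf : LengthLE p f) {a : ℕ} (ha : 0 < a) :
    LengthLE (p - 1) (slice a f) := by
  intro w hw
  rw [← wcoeff_cons ha]
  refine hf _ ?_
  push_cast [List.length_cons]
  omega

/-- A word of the product is a quasi-shuffle of words of the factors; merging letters only shortens
it. -/
theorem LengthLE.mul {p q : ℤ} {f g : MvPowerSeries ℕ ℤ} (hf : LengthLE p f) (hg : LengthLE q g)
    (hfQ : f ∈ QSymm) (hgQ : g ∈ QSymm) : LengthLE (p + q) (f * g) := by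
  intro w
  induction w generalizing p q f g with
  | nil =>
    intro hw
    -- A negative bound excludes even the empty word. Integer bounds let `p - 1` be used in the
    -- recursion without a case distinction.
    have hpq : p < 0 ∨ q < 0 := by
      simp at hw
      omega
    have h0 : wcoeff [] (f * g) = wcoeff [] f * wcoeff [] g := by
      simp [wcoeff_nil, coeff_mul]
    rw [h0]
    rcases hpq with h | h
    · rw [hf [] (by simpa using h), zero_mul]
    · rw [hg [] (by simpa using h), mul_zero]
  | cons a w ih =>
    intro hw
    rcases Nat.eq_zero_or_pos a with rfl | ha
    · exact wcoeff_zero_cons _ _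
    rw [wcoeff_cons ha, slice_mul, map_sum]
    push_cast [List.length_cons] at hw
    refine Finset.sum_eq_zero fun x hx => ?_
    rw [Finset.HasAntidiagonal.mem_antidiagonal] at hx
    rcases Nat.eq_zero_or_pos x.1 with h1 | h1
    · rw [h1, slice_zero hfQ]
      exact ih hf (hg.slice (by omega)) hfQ (slice_mem _ hgQ) (by omega)
    · rcases Nat.eq_zero_or_pos x.2 with h2 | h2
      · rw [h2, slice_zero hgQ]
        exact ih (hf.slice h1) hg (slice_mem _ hfQ) hgQ (by omega)
      · exact ih (hf.slice h1) (hg.slice h2) (slice_mem _ hfQ) (slice_mem _ hgQ) (by omega)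

theorem top_cons {p : ℤ} {f : MvPowerSeries ℕ ℤ} {a : ℕ} (ha : 0 < a) :
    (fun u => top p f (a :: u)) = top (p - 1) (slice a f) := by
  funext u
  rw [top, top, wcoeff_cons ha]
  refine if_congr ?_ rfl rfl
  push_cast [List.length_cons]
  omega

theorem top_zero_cons {p : ℤ} {f : MvPowerSeries ℕ ℤ} (u : List ℕ) : top p f (0 :: u) = 0 := by
  rw [top, wcoeff_zero_cons, ite_self]

/-- The longest words of a product are given by the shuffle product. -/
theorem top_mul {p q : ℤ} {f g : MvPowerSeries ℕ ℤ} (hf : LengthLE p f) (hg : LengthLE q g)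
    (hfQ : f ∈ QSymm) (hgQ : g ∈ QSymm) :
    top (p + q) (f * g) = shuffle (top p f) (top q g) := by
  funext w
  induction w generalizing p q f g with
  | nil =>
    have h0 : wcoeff [] (f * g) = wcoeff [] f * wcoeff [] g := by
      simp [wcoeff_nil, coeff_mul]
    rw [shuffle_nil, top, top, top, h0]
    simp only [List.length_nil, Nat.cast_zero]
    by_cases hp : p = 0
    · by_cases hq : q = 0
      · simp [hp, hq]
      · rw [if_neg (by omega), if_neg (c := 0 = q) (fun h => hq h.symm), mul_zero]
    · rw [if_neg (c := 0 = p) (fun h => hp h.symm), zero_mul]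
      split_ifs with h
      · rcases lt_or_ge p 0 with hp' | hp'
        · rw [hf [] (by simpa using hp'), zero_mul]
        · rw [hg [] (by simp; omega), mul_zero]
      · rfl
  | cons a w ih =>
    rcases Nat.eq_zero_or_pos a with rfl | ha
    -- The convention that words containing `0` have coefficient `0` makes both sides vanish.
    · rw [top_zero_cons]
      by_contra hne
      obtain ⟨u, v, hs, hu, hv⟩ := exists_isShuffle (Ne.symm hne)
      cases hs with
      | left _ => exact hu (top_zero_cons _)
      | right _ => exact hv (top_zero_cons _)
    · rw [shuffle_cons, top_cons ha, top_cons ha,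
        ← ih (hf.slice ha) hg (slice_mem _ hfQ) hgQ, ← ih hf (hg.slice ha) hfQ (slice_mem _ hgQ),
        congrFun (top_cons ha) w, slice_mul]
      rw [show p - 1 + q = p + q - 1 by ring, show p + (q - 1) = p + q - 1 by ring]
      simp only [top]
      split_ifs with hw
      -- Only the two unmerged terms survive: merging a letter of each factor leaves words of length
      -- at most `p + q - 2`, while `w` has length `p + q - 1`.
      · rw [map_sum, Finset.sum_eq_add (a, 0) (0, a) (by simp [ha.ne']), slice_zero hfQ,
          slice_zero hgQ]
        · intro x hx hne
          rw [Finset.HasAntidiagonal.mem_antidiagonal] at hx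
          have h1 : 0 < x.1 := by
            rcases Nat.eq_zero_or_pos x.1 with h | h
            · exact absurd (Prod.ext h (by simp; omega)) hne.2
            · exact h
          have h2 : 0 < x.2 := by
            rcases Nat.eq_zero_or_pos x.2 with h | h
            · exact absurd (Prod.ext (by simp; omega) h) hne.1
            · exact h
          exact (hf.slice h1).mul (hg.slice h2) (slice_mem _ hfQ) (slice_mem _ hgQ) w (by omega)
        · simp
        · simp
      · simp

end QuasiSym

/-! ### The lambda operations on monomial quasisymmetric functions -/

namespace QuasiSym

open MvPowerSeries Word

theorem word_nsmul {k : ℕ} (hk : k ≠ 0) (s : ℕ →₀ ℕ) : word (k • s) = (word s).map (k * ·) := by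
  have h : (k • s).support = s.support := by
    ext x
    simp [hk]
  rw [word, word, h, List.map_map]
  rfl

/-- Adams operations scale the entries of a composition. This keeps word lengths in the Newton
relations under control, and later reduces all Lyndon compositions to those with gcd `1`. -/
theorem adams_monomialQSymm (i : ℕ) (α : List ℕ) :
    PowerSeriesLambda.adams i (monomialQSymm α) = monomialQSymm (α.map ((i + 1) * ·)) := by
  ext s
  rw [coeff_monomialQSymm]
  by_cases hs : ∀ j, i + 1 ∣ s j
  · obtain ⟨v, rfl⟩ : ∃ v, s = (i + 1) • v := by
      refine ⟨s.mapRange (· / (i + 1)) (Nat.zero_div _), ?_⟩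
      ext j
      simp [Nat.mul_div_cancel' (hs j)]
    refine (coeff_expand_smul _ _ _ _).trans ?_
    rw [coeff_monomialQSymm, word_nsmul (by omega)]
    refine if_congr ?_ rfl rfl
    refine ⟨fun h => by rw [h], fun h => ?_⟩
    exact List.map_injective_iff.2 (mul_right_injective₀ (Nat.succ_ne_zero i)) h
  · push Not at hs
    obtain ⟨j, hj⟩ := hs
    refine (coeff_expand_of_not_dvd _ _ _ hj).trans (if_neg fun h => hj ?_).symm
    have hmem : s j ∈ word s := by
      refine List.mem_map.2 ⟨j, ?_, rfl⟩
      rw [Finset.mem_sort, Finsupp.mem_support_iff]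
      intro h0
      exact hj (h0 ▸ dvd_zero _)
    rw [h, List.mem_map] at hmem
    obtain ⟨x, _, hx⟩ := hmem
    exact hx ▸ dvd_mul_right _ _

/-- Quasisymmetry is a set of linear conditions on integer coefficients, so it survives the division
by `n + 1` in the Newton relations. -/
theorem mem_of_natCast_mul_mem {n : ℕ} {f : MvPowerSeries ℕ ℤ}
    (h : ((n + 1 : ℕ) : MvPowerSeries ℕ ℤ) * f ∈ QSymm) : f ∈ QSymm := by
  have hc : ∀ s, coeff s (((n + 1 : ℕ) : MvPowerSeries ℕ ℤ) * f) = ((n + 1 : ℕ) : ℤ) * coeff s f := by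
    intro s
    rw [← nsmul_eq_mul, map_nsmul, nsmul_eq_mul]
  have hn : ((n + 1 : ℕ) : ℤ) ≠ 0 := by positivity
  obtain ⟨⟨d, hd⟩, hq⟩ := h
  refine ⟨⟨d, fun s hs => ?_⟩, fun m a i j ha hi hj => ?_⟩
  · have := hd s hs
    rw [hc] at this
    exact (mul_eq_zero.1 this).resolve_left hn
  · have := hq m a i j ha hi hj
    rw [hc, hc] at this
    exact mul_left_cancel₀ hn this

theorem lam_monomialQSymm_mem (α : List ℕ) (n : ℕ) :
    PowerSeriesLambda.lam n (monomialQSymm α) ∈ QSymm := by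
  induction n using Nat.strong_induction_on with
  | _ n ih =>
    cases n with
    | zero =>
      rw [PowerSeriesLambda.lam_zero]
      exact one_mem _
    | succ n =>
      refine mem_of_natCast_mul_mem (n := n) ?_
      rw [PowerSeriesLambda.newton]
      refine sum_mem fun p hp => mul_mem (mul_mem (pow_mem (neg_mem (one_mem _)) _) ?_) (ih _ ?_)
      · rw [adams_monomialQSymm]
        exact monomialQSymm_mem _
      · rw [Finset.HasAntidiagonal.mem_antidiagonal] at hp
        omega

theorem neg_one_pow_mul_mul (k : ℕ) (f g : MvPowerSeries ℕ ℤ) :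
    (-1) ^ k * f * g = ((-1) ^ k : ℤ) • (f * g) := by
  rw [zsmul_eq_mul, mul_assoc]
  push_cast
  rfl

theorem lengthLE_monomialQSymm (α : List ℕ) : LengthLE α.length (monomialQSymm α) := by
  intro w hw
  by_cases h0 : 0 ∈ w
  · exact wcoeff_of_mem h0 _
  · rw [wcoeff_of_notMem h0, coeff_monomialQSymm, word_expo h0, if_neg]
    rintro rfl
    exact lt_irrefl _ hw

theorem lengthLE_one : LengthLE 0 1 := by
  intro w hw
  rw [wcoeff_one, Pi.single_eq_of_ne]
  rintro rfl
  simp at hw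

/-- In the Newton relation for `λ_{n+1}`, an Adams factor contributes at most `α.length` letters
whatever its index, and the other factor is bounded by induction. -/
theorem lengthLE_lam (α : List ℕ) (n : ℕ) :
    LengthLE (n * α.length) (PowerSeriesLambda.lam n (monomialQSymm α)) := by
  induction n using Nat.strong_induction_on with
  | _ n ih =>
    cases n with
    | zero =>
      rw [PowerSeriesLambda.lam_zero]
      simpa using lengthLE_one
    | succ n =>
      intro w hw
      have h := congrArg (wcoeff w) (PowerSeriesLambda.newton n (monomialQSymm α))
      rw [← nsmul_eq_mul, map_nsmul, map_sum, Finset.sum_eq_zero, smul_eq_zero] at h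
      · exact h.resolve_left (by omega)
      · intro p hp
        rw [Finset.HasAntidiagonal.mem_antidiagonal] at hp
        rw [neg_one_pow_mul_mul, map_zsmul, adams_monomialQSymm,
          (lengthLE_monomialQSymm _).mul (ih p.2 (by omega)) (monomialQSymm_mem _)
          (lam_monomialQSymm_mem _ _), smul_zero]
        refine lt_of_le_of_lt ?_ hw
        rw [List.length_map]
        have : ((p.2 : ℤ) + 1) * α.length ≤ (n + 1 : ℕ) * α.length := by
          refine mul_le_mul_of_nonneg_right ?_ (by positivity)
          push_cast
          omega
        linarith

/-- All monomials of `f` have degree `d`. -/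
def IsHomogeneousOfDegree (d : ℕ) (f : MvPowerSeries ℕ ℤ) : Prop :=
  ∀ s : ℕ →₀ ℕ, coeff s f ≠ 0 → s.degree = d

theorem isHomogeneousOfDegree_one : IsHomogeneousOfDegree 0 1 := by
  intro s hs
  rw [coeff_one] at hs
  have : s = 0 := by
    by_contra h
    exact hs (if_neg h)
  rw [this, map_zero]

theorem IsHomogeneousOfDegree.mul {d e : ℕ} {f g : MvPowerSeries ℕ ℤ}
    (hf : IsHomogeneousOfDegree d f) (hg : IsHomogeneousOfDegree e g) :
    IsHomogeneousOfDegree (d + e) (f * g) := by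
  intro s hs
  rw [coeff_mul] at hs
  obtain ⟨p, hp, hne⟩ := Finset.exists_ne_zero_of_sum_ne_zero hs
  rw [Finset.HasAntidiagonal.mem_antidiagonal] at hp
  rw [← hp, map_add, hf _ (left_ne_zero_of_mul hne), hg _ (right_ne_zero_of_mul hne)]

theorem IsHomogeneousOfDegree.pow {d : ℕ} {f : MvPowerSeries ℕ ℤ}
    (hf : IsHomogeneousOfDegree d f) (n : ℕ) : IsHomogeneousOfDegree (n * d) (f ^ n) := by
  induction n with
  | zero => simpa using isHomogeneousOfDegree_one
  | succ n ih =>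
    rw [_root_.pow_succ, add_mul, one_mul]
    exact ih.mul hf

theorem isHomogeneousOfDegree_prod {ι : Type*} (S : Finset ι) {f : ι → MvPowerSeries ℕ ℤ}
    {d : ι → ℕ} (h : ∀ i ∈ S, IsHomogeneousOfDegree (d i) (f i)) :
    IsHomogeneousOfDegree (∑ i ∈ S, d i) (∏ i ∈ S, f i) := by
  classical
  induction S using Finset.induction_on with
  | empty => simpa using isHomogeneousOfDegree_one
  | insert i S hi ih =>
    rw [Finset.sum_insert hi, Finset.prod_insert hi]
    exact (h i (Finset.mem_insert_self i S)).mul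
      (ih fun j hj => h j (Finset.mem_insert_of_mem hj))

theorem isHomogeneousOfDegree_monomialQSymm (α : List ℕ) :
    IsHomogeneousOfDegree α.sum (monomialQSymm α) := by
  intro s hs
  rw [coeff_monomialQSymm] at hs
  have : word s = α := by
    by_contra h
    exact hs (if_neg h)
  rw [← this, sum_word]

theorem isHomogeneousOfDegree_lam (α : List ℕ) (n : ℕ) :
    IsHomogeneousOfDegree (n * α.sum) (PowerSeriesLambda.lam n (monomialQSymm α)) := by
  induction n using Nat.strong_induction_on with
  | _ n ih =>
    cases n with
    | zero =>
      rw [PowerSeriesLambda.lam_zero]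
      simpa using isHomogeneousOfDegree_one
    | succ n =>
      intro s hs
      have h := congrArg (coeff s) (PowerSeriesLambda.newton n (monomialQSymm α))
      rw [← nsmul_eq_mul, map_nsmul, map_sum] at h
      have hne := h.symm.trans_ne (smul_ne_zero (by omega) hs)
      obtain ⟨p, hp, hne⟩ := Finset.exists_ne_zero_of_sum_ne_zero hne
      rw [Finset.HasAntidiagonal.mem_antidiagonal] at hp
      rw [neg_one_pow_mul_mul, map_zsmul, adams_monomialQSymm] at hne
      rw [((isHomogeneousOfDegree_monomialQSymm _).mul (ih p.2 (by omega))) s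
        (right_ne_zero_of_smul hne), List.sum_map_mul_left, ← hp]
      simp
      ring

/-- `f` is quasisymmetric, and `w` is its largest word in the length-lexicographic order, with
coefficient `1`. -/
def HasLeadingWord (w : List ℕ) (f : MvPowerSeries ℕ ℤ) : Prop :=
  f ∈ QSymm ∧ LengthLE w.length f ∧ Leads w (top w.length f)

theorem HasLeadingWord.mul {α β : List ℕ} {f g : MvPowerSeries ℕ ℤ} (hf : HasLeadingWord α f)
    (hg : HasLeadingWord β g) (h : ∀ s, s <:+ α → s ≠ [] → β < s) :
    HasLeadingWord (α ++ β) (f * g) := by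
  have e : ((α ++ β).length : ℤ) = α.length + β.length := by simp
  refine ⟨mul_mem hf.1 hg.1, ?_, ?_⟩
  · rw [e]
    exact hf.2.1.mul hg.2.1 hf.1 hg.1
  · rw [e, top_mul hf.2.1 hg.2.1 hf.1 hg.1]
    exact hf.2.2.shuffle hg.2.2 h

theorem hasLeadingWord_one : HasLeadingWord [] 1 := by
  refine ⟨one_mem _, by simpa using lengthLE_one, ?_⟩
  have : top ([] : List ℕ).length 1 = Pi.single [] 1 := by
    funext w
    rw [top, wcoeff_one]
    split_ifs with h
    · rfl
    · rw [Pi.single_eq_of_ne]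
      rintro rfl
      exact h rfl
  rw [this]
  exact leads_single _

/-- On words of maximal length the Newton relation reduces to `(n + 1) λ_{n+1}(l) = l * λ_n(l)` with
the shuffle product, so that `leads_pow` applies. -/
theorem hasLeadingWord_lam {l : List ℕ} (hl : IsLyndonWord l) (h0 : 0 ∉ l) (n : ℕ) :
    HasLeadingWord (pow l n) (PowerSeriesLambda.lam n (monomialQSymm l)) := by
  have hpos : 0 < l.length := List.length_pos_iff.2 hl.1
  refine ⟨lam_monomialQSymm_mem _ _, ?_, ?_⟩
  · simpa [length_pow] using lengthLE_lam l n
  · have htop : top l.length (monomialQSymm l) = Pi.single l 1 := by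
      funext w
      rw [top, wcoeff_monomialQSymm h0]
      split_ifs with h
      · rfl
      · rw [Pi.single_eq_of_ne]
        rintro rfl
        exact h rfl
    have h := leads_pow hl
      (E := fun n => top (n * l.length : ℤ) (PowerSeriesLambda.lam n (monomialQSymm l))) ?_ ?_ n
    · simpa [length_pow] using h
    · funext w
      simp only [PowerSeriesLambda.lam_zero, top, wcoeff_one, Nat.cast_zero, zero_mul]
      split_ifs with h
      · rfl
      · rw [Pi.single_eq_of_ne]
        rintro rfl
        exact h rfl
    · intro n
      rw [← htop, ← top_mul (lengthLE_monomialQSymm _) (lengthLE_lam _ _) (monomialQSymm_mem _)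
        (lam_monomialQSymm_mem _ _)]
      funext w
      rw [Pi.smul_apply, top, top]
      have e : ((n + 1 : ℕ) : ℤ) * l.length = l.length + n * l.length := by push_cast; ring
      rw [e]
      split_ifs with hw
      · have h := congrArg (wcoeff w) (PowerSeriesLambda.newton n (monomialQSymm l))
        rw [← nsmul_eq_mul, map_nsmul, map_sum, Finset.sum_eq_single (0, n)] at h
        · rw [adams_monomialQSymm] at h
          simpa using h
        · intro p hp hne
          rw [Finset.HasAntidiagonal.mem_antidiagonal] at hp
          -- Any term other than `(0, n)` has at most `(1 + p.2) * l.length` letters, strictly fewer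
          -- than the length of `w`.
          have hp2 : p.2 < n := by
            by_contra hlt
            exact hne (Prod.ext (by simp; omega) (by simp; omega))
          rw [neg_one_pow_mul_mul, map_zsmul, adams_monomialQSymm,
            (lengthLE_monomialQSymm _).mul (lengthLE_lam _ _) (monomialQSymm_mem _)
            (lam_monomialQSymm_mem _ _), smul_zero]
          rw [hw, List.length_map]
          have : (p.2 : ℤ) * l.length < n * l.length :=
            mul_lt_mul_of_pos_right (by exact_mod_cast hp2) (by exact_mod_cast hpos)
          linarith
        · simp
      · simp

end QuasiSym

/-! ### Generators from all Lyndon words -/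

namespace Word

/-- A nonempty word has a Lyndon suffix that is minimal among its nonempty suffixes. -/
theorem exists_minimal_suffix {w : List ℕ} (hw : w ≠ []) : ∃ l, l <:+ w ∧ IsLyndonWord l ∧
    ∀ s, s <:+ w → s ≠ [] → l ≤ s := by
  obtain ⟨l, hl, hmin⟩ := Finset.exists_min_image (w.tails.toFinset.filter (· ≠ [])) id
    ⟨w, by simp [hw]⟩
  simp only [Finset.mem_filter, List.mem_toFinset, List.mem_tails, id] at hl hmin
  refine ⟨l, hl.1, ⟨hl.2, fun u v huv hu hv => ?_⟩, fun s hs hne => hmin s ⟨hs, hne⟩⟩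
  refine lt_of_le_of_ne (hmin v ⟨List.IsSuffix.trans ⟨u, huv.symm⟩ hl.1, hv⟩) fun h => hu ?_
  rw [h] at huv
  simpa using huv

theorem pow_succ' (l : List ℕ) (n : ℕ) : pow l (n + 1) = pow l n ++ l := by
  induction n with
  | zero => simp [pow]
  | succ n ih =>
    conv_lhs => rw [pow_succ, ih]
    rw [pow_succ, List.append_assoc]

theorem exists_eq_append_pow {l : List ℕ} (hl : l ≠ []) (w : List ℕ) :
    ∃ v n, w = v ++ pow l n ∧ ¬ l <:+ v := by
  induction h : w.length using Nat.strong_induction_on generalizing w with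
  | _ k ih =>
    by_cases hs : l <:+ w
    · obtain ⟨u, rfl⟩ := hs
      have := List.length_pos_iff.2 hl
      obtain ⟨v, n, rfl, hv⟩ := ih u.length (by simp at h; omega) u rfl
      exact ⟨v, n + 1, by rw [pow_succ', List.append_assoc], hv⟩
    · exact ⟨w, 0, by simp [pow], hs⟩

end Word

namespace QuasiSym

open MvPowerSeries Word

/-- The values of the lambda operations on the Lyndon compositions. -/
def lyndonLam : Set (MvPowerSeries ℕ ℤ) :=
  {f | ∃ l n, IsLyndonWord l ∧ 0 ∉ l ∧ f = PowerSeriesLambda.lam n (monomialQSymm l)}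

theorem sum_pow (l : List ℕ) (n : ℕ) : (pow l n).sum = n * l.sum := by
  simp [pow, List.sum_flatten]

/-- Write `w = v ++ l ^ n` with `l` the minimal nonempty suffix and `n` maximal. The suffixes of `v`
then exceed `l ^ n`, so leading words concatenate when the element for `v` is multiplied by
`λ_n(l)`. -/
theorem exists_hasLeadingWord (w : List ℕ) (hw : 0 ∉ w) : ∃ f ∈ Algebra.adjoin ℤ lyndonLam,
    HasLeadingWord w f ∧ IsHomogeneousOfDegree w.sum f := by
  induction h : w.length using Nat.strong_induction_on generalizing w with
  | _ k ih =>
    by_cases hne : w = []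
    · subst hne
      exact ⟨1, one_mem _, hasLeadingWord_one, isHomogeneousOfDegree_one⟩
    · obtain ⟨l, hlw, hl, hmin⟩ := exists_minimal_suffix hne
      obtain ⟨v, n, rfl, hv⟩ := exists_eq_append_pow hl.1 w
      have hl0 : 0 ∉ l := fun h => hw (hlw.subset h)
      have hn : 0 < n := by
        rcases Nat.eq_zero_or_pos n with rfl | hn
        · exact absurd (by simpa [pow] using hlw) hv
        · exact hn
      have hpos : 0 < n * l.length := Nat.mul_pos hn (List.length_pos_iff.2 hl.1)
      obtain ⟨f, hf, hlead, hhom⟩ := ih v.length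
        (by rw [← h, List.length_append, length_pow]; omega) v
        (fun h => hw (List.mem_append_left _ h)) rfl
      refine ⟨f * PowerSeriesLambda.lam n (monomialQSymm l),
        mul_mem hf (Algebra.subset_adjoin ⟨l, n, hl, hl0, rfl⟩),
        hlead.mul (hasLeadingWord_lam hl hl0 n) fun s hs hne =>
          pow_lt_of_suffix_append hl hn hmin hv hs hne n, ?_⟩
      rw [List.sum_append, sum_pow]
      exact hhom.mul (isHomogeneousOfDegree_lam l n)

theorem zero_notMem_blocks {N : ℕ} (c : Composition N) : 0 ∉ c.blocks :=
  fun h => (c.blocks_pos h).ne rfl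

/-- The composition with given positive blocks. -/
def toComposition {N : ℕ} (w : List ℕ) (h0 : 0 ∉ w) (hw : w.sum = N) : Composition N where
  blocks := w
  blocks_pos := fun hi => Nat.pos_of_ne_zero fun h => h0 (h ▸ hi)
  blocks_sum := hw

/-- A quasisymmetric function is a combination of the monomial ones that occur in it. -/
theorem mem_of_forall_monomialQSymm_mem {A : Subalgebra ℤ (MvPowerSeries ℕ ℤ)}
    {f : MvPowerSeries ℕ ℤ} (hf : f ∈ QSymm)
    (h : ∀ w, wcoeff w f ≠ 0 → monomialQSymm w ∈ A) : f ∈ A := by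
  obtain ⟨d, hd⟩ := hf.1
  have e : f = ∑ N ∈ Finset.range (d + 1), ∑ c : Composition N,
      wcoeff c.blocks f • monomialQSymm c.blocks := by
    refine ext_wcoeff hf (sum_mem fun N _ => sum_mem fun c _ =>
      zsmul_mem (monomialQSymm_mem _) _) fun w hw => ?_
    simp only [map_sum, map_zsmul, wcoeff_monomialQSymm (zero_notMem_blocks _)]
    have hin : ∀ N ∈ Finset.range (d + 1), N ≠ w.sum → ∑ c : Composition N,
        wcoeff c.blocks f • (Pi.single c.blocks 1 : List ℕ → ℤ) w = 0 := by
      intro N _ hN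
      refine Finset.sum_eq_zero fun c _ => ?_
      rw [Pi.single_eq_of_ne, smul_zero]
      rintro rfl
      exact hN c.blocks_sum.symm
    by_cases hwd : w.sum < d + 1
    · rw [Finset.sum_eq_single w.sum hin (fun h => absurd (Finset.mem_range.2 hwd) h),
        Finset.sum_eq_single (toComposition w hw rfl)]
      · simp [toComposition]
      · intro c _ hc
        rw [Pi.single_eq_of_ne, smul_zero]
        intro h
        exact hc (Composition.ext h.symm)
      · simp
    · rw [Finset.sum_eq_zero fun N hN => hin N hN (by rw [Finset.mem_range] at hN; omega),
        wcoeff_of_notMem hw]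
      refine hd _ ?_
      rw [← sum_word, word_expo hw]
      omega
  rw [e]
  refine sum_mem fun N _ => sum_mem fun c _ => ?_
  by_cases h0 : wcoeff c.blocks f = 0
  · rw [h0, zero_smul]
    exact zero_mem _
  · exact zsmul_mem (h _ h0) _

/-- Unitriangularity: the element with leading word `w` differs from the monomial function of `w` by
smaller words only. Homogeneity keeps the induction among compositions of one number, of which there
are finitely many. -/
theorem monomialQSymm_mem_adjoin_lyndonLam (w : List ℕ) (hw : 0 ∉ w) :
    monomialQSymm w ∈ Algebra.adjoin ℤ lyndonLam := by
  let r : List ℕ → List ℕ → Prop := fun u v => u.length < v.length ∨ u.length = v.length ∧ u < v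
  suffices H : ∀ (N : ℕ) (c : Composition N), monomialQSymm c.blocks ∈ Algebra.adjoin ℤ lyndonLam
    from H _ (toComposition w hw rfl)
  intro N
  let R : Composition N → Composition N → Prop := fun c d => r c.blocks d.blocks
  have : IsTrans (Composition N) R := ⟨fun a b c hab hbc => by
    rcases hab with h | ⟨h, h'⟩ <;> rcases hbc with k | ⟨k, k'⟩
    · exact Or.inl (h.trans k)
    · exact Or.inl (h.trans_eq k)
    · exact Or.inl (h.trans_lt k)
    · exact Or.inr ⟨h.trans k, h'.trans k'⟩⟩
  have : Std.Irrefl R := ⟨fun a h => by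
    rcases h with h | h
    · exact lt_irrefl _ h
    · exact lt_irrefl _ h.2⟩
  have hwf : WellFounded R := Finite.wellFounded_of_trans_of_irrefl R
  intro c
  induction c using hwf.induction with
  | _ c ih =>
    obtain ⟨f, hf, hlead, hhom⟩ := exists_hasLeadingWord c.blocks (zero_notMem_blocks c)
    rw [← sub_sub_cancel f (monomialQSymm c.blocks)]
    refine sub_mem hf (mem_of_forall_monomialQSymm_mem
      (sub_mem hlead.1 (monomialQSymm_mem _)) fun v hv => ?_)
    rw [map_sub, wcoeff_monomialQSymm (zero_notMem_blocks c)] at hv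
    have hvc : v ≠ c.blocks := by
      rintro rfl
      have := hlead.2.2.1
      rw [top, if_pos rfl] at this
      rw [this, Pi.single_eq_same, sub_self] at hv
      exact hv rfl
    rw [Pi.single_eq_of_ne hvc, sub_zero] at hv
    obtain ⟨h0, hsum⟩ := wcoeff_eq_zero_of_degree hhom hv
    refine ih (toComposition v h0 (hsum.trans c.blocks_sum)) ?_
    change r v c.blocks
    have hlen : v.length ≤ c.blocks.length := by
      by_contra hlt
      exact hv (hlead.2.1 v (by exact_mod_cast not_le.1 hlt))
    rcases hlen.lt_or_eq with hlt | heq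
    · exact Or.inl hlt
    · refine Or.inr ⟨heq, lt_of_le_of_ne (hlead.2.2.2 v ?_).2 hvc⟩
      rwa [top, if_pos (by exact_mod_cast heq)]

theorem adjoin_lyndonLam : Algebra.adjoin ℤ lyndonLam = QSymm := by
  refine le_antisymm (Algebra.adjoin_le ?_) fun f hf => ?_
  · rintro f ⟨l, n, _, _, rfl⟩
    exact lam_monomialQSymm_mem l n
  · refine mem_of_forall_monomialQSymm_mem hf fun w hw =>
      monomialQSymm_mem_adjoin_lyndonLam w fun h0 => hw (wcoeff_of_mem h0 f)

end QuasiSym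

/-! ### Lambda operations of Adams operations -/

namespace Newton

variable {R : Type*} [CommRing R]

/-- The Newton relations between a sequence `e` with `e 0 = 1` and a sequence `p`, whose indices
are shifted by one. -/
def Relations (e p : ℕ → R) : Prop :=
  e 0 = 1 ∧ ∀ n : ℕ, ((n + 1 : ℕ) : R) * e (n + 1) =
    ∑ x ∈ Finset.HasAntidiagonal.antidiagonal n, (-1) ^ x.1 * p x.1 * e x.2

/-- Since `e 0 = 1`, the relation of index `n` contains `p n` with coefficient `±1`, so it
determines `p n` from `e` and the earlier terms over any ring. -/
theorem Relations.power_eq {e p e' p' : ℕ → R} (h : Relations e p) (h' : Relations e' p') {m : ℕ}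
    (he : ∀ n ≤ m, e n = e' n) (n : ℕ) (hn : n < m) : p n = p' n := by
  induction n using Nat.strong_induction_on with
  | _ n ih =>
    have h1 := h.2 n
    rw [he _ hn, h'.2 n, Finset.sum_eq_sum_sdiff_singleton_add (i := (n, 0)) (by simp),
      Finset.sum_eq_sum_sdiff_singleton_add (s := Finset.HasAntidiagonal.antidiagonal n)
        (i := (n, 0)) (f := fun x => (-1) ^ x.1 * p x.1 * e x.2) (by simp)] at h1
    have h2 : ∀ x ∈ Finset.HasAntidiagonal.antidiagonal n \ {(n, 0)},
        (-1) ^ x.1 * p' x.1 * e' x.2 = (-1) ^ x.1 * p x.1 * e x.2 := by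
      intro x hx
      rw [Finset.mem_sdiff, Finset.HasAntidiagonal.mem_antidiagonal, Finset.mem_singleton] at hx
      have hx1 : x.1 < n := by
        by_contra hlt
        exact hx.2 (Prod.ext (by simp; omega) (by simp; omega))
      rw [ih x.1 hx1 (hx1.trans hn), he x.2 (by omega)]
    rw [Finset.sum_congr rfl h2, add_right_inj] at h1
    dsimp only at h1
    rw [h.1, h'.1, mul_one, mul_one] at h1
    have h3 : ((-1) ^ n * (-1) ^ n : R) = 1 := by rw [← mul_pow]; simp
    calc p n = (-1) ^ n * ((-1) ^ n * p n) := by rw [← mul_assoc, h3, one_mul]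
      _ = p' n := by rw [← h1, ← mul_assoc, h3, one_mul]

/-- In this direction one divides by `n + 1`, whence the absence of torsion. -/
theorem Relations.eq_of_power_eq [IsAddTorsionFree R] {e p e' p' : ℕ → R} (h : Relations e p)
    (h' : Relations e' p') {m : ℕ} (hp : ∀ n < m, p n = p' n) (n : ℕ) (hn : n ≤ m) :
    e n = e' n := by
  induction n using Nat.strong_induction_on with
  | _ n ih =>
    cases n with
    | zero => rw [h.1, h'.1]
    | succ n =>
      refine nsmul_right_injective (Nat.succ_ne_zero n) ?_
      simp only [nsmul_eq_mul]
      rw [h.2, h'.2]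
      refine Finset.sum_congr rfl fun x hx => ?_
      rw [Finset.HasAntidiagonal.mem_antidiagonal] at hx
      rw [hp x.1 (by omega), ih x.2 (by omega) (by omega)]

theorem Relations.map {S : Type*} [CommRing S] {e p : ℕ → R} (h : Relations e p) (φ : R →+* S) :
    Relations (fun n => φ (e n)) (fun n => φ (p n)) := by
  refine ⟨by simp [h.1], fun n => ?_⟩
  have := congrArg φ (h.2 n)
  simpa [map_sum] using this

theorem relations_esymm (σ : Type*) [Fintype σ] : Relations
    (fun n => MvPolynomial.esymm σ ℤ n) (fun n => MvPolynomial.psum σ ℤ (n + 1)) := by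
  refine ⟨MvPolynomial.esymm_zero σ ℤ, fun n => ?_⟩
  rw [MvPolynomial.mul_esymm_eq_sum, Finset.mul_sum]
  refine Finset.sum_bij' (fun x _ => (x.2 - 1, x.1)) (fun x _ => (x.2, x.1 + 1)) ?_ ?_ ?_ ?_ ?_
  · intro x hx
    simp only [Finset.mem_filter, Finset.HasAntidiagonal.mem_antidiagonal] at hx ⊢
    omega
  · intro x hx
    simp only [Finset.mem_filter, Finset.HasAntidiagonal.mem_antidiagonal] at hx ⊢
    omega
  · intro x hx
    simp only [Finset.mem_filter, Finset.HasAntidiagonal.mem_antidiagonal] at hx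
    exact Prod.ext rfl (by simp; omega)
  · intro x _
    rfl
  · intro x hx
    simp only [Finset.mem_filter, Finset.HasAntidiagonal.mem_antidiagonal] at hx
    obtain ⟨i, j⟩ := x
    obtain ⟨j, rfl⟩ : ∃ k, j = k + 1 := ⟨j - 1, by simp at hx; omega⟩
    obtain rfl : n = i + j := by simp at hx; omega
    have h3 : ((-1) ^ i * (-1) ^ i : MvPolynomial σ ℤ) = 1 := by rw [← mul_pow]; simp
    simp only [Nat.add_sub_cancel]
    linear_combination ((-1) ^ j * MvPolynomial.psum σ ℤ (j + 1) * MvPolynomial.esymm σ ℤ i) * h3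

end Newton

namespace PowerSeriesLambda

open MvPolynomial Newton

theorem relations (a : MvPowerSeries ℕ ℤ) :
    Relations (fun n => lam n a) (fun n => adams n a) := ⟨lam_zero a, fun n => newton n a⟩

theorem isSymmetric_expand {σ : Type*} {f : MvPolynomial σ ℤ} (hf : f.IsSymmetric) (d : ℕ) :
    (expand d f).IsSymmetric := by
  intro e
  rw [rename_expand, hf e]

/-- The lambda operations on `ψ_{d+1}(a)` are polynomials in the `λ_k(a)`. -/
theorem lam_adams_mem (a : MvPowerSeries ℕ ℤ) (d n : ℕ) :
    lam n (adams d a) ∈ Algebra.adjoin ℤ (Set.range fun k => lam (k + 1) a) := by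
  -- The first `n` power sums of the `x_i ^ (d + 1)` are power sums of the `x_i` of index up to `n *
  -- (d + 1)`; with this many variables the elementary symmetric polynomials up to that index are
  -- free generators.
  set m := n * (d + 1) with hm
  let S := symmetricSubalgebra (Fin m) ℤ
  -- By the fundamental theorem on symmetric polynomials, the elementary ones may be sent to the
  -- `λ_k(a)`. Newton's relations then force the power sums to go to the Adams operations.
  let Φ : S →ₐ[ℤ] MvPowerSeries ℕ ℤ := (aeval fun i : Fin m => lam (i + 1) a).comp
    ((esymmAlgEquiv (Fin m) ℤ (Fintype.card_fin m)).symm : S →ₐ[ℤ] MvPolynomial (Fin m) ℤ)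
  let es : ℕ → S := fun k => ⟨esymm (Fin m) ℤ k, esymm_isSymmetric _ _ k⟩
  let ps : ℕ → S := fun k => ⟨psum (Fin m) ℤ (k + 1), psum_isSymmetric _ _ _⟩
  let es' : ℕ → S := fun k => ⟨expand (d + 1) (esymm (Fin m) ℤ k),
    isSymmetric_expand (esymm_isSymmetric _ _ k) _⟩
  let ps' : ℕ → S := fun k => ⟨expand (d + 1) (psum (Fin m) ℤ (k + 1)),
    isSymmetric_expand (psum_isSymmetric _ _ _) _⟩
  have hrel : Relations es ps := by
    have h := relations_esymm (Fin m)
    refine ⟨Subtype.ext h.1, fun k => Subtype.ext ?_⟩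
    have := h.2 k
    simpa [es, ps] using this
  have hrel' : Relations es' ps' := by
    have h := (relations_esymm (Fin m)).map (expand (d + 1) : _ →ₐ[ℤ] _).toRingHom
    refine ⟨Subtype.ext h.1, fun k => Subtype.ext ?_⟩
    have := h.2 k
    simpa [es', ps'] using this
  have hes : ∀ k ≤ m, Φ (es k) = lam k a := by
    intro k hk
    cases k with
    | zero =>
      rw [hrel.1, map_one, lam_zero]
    | succ k =>
      have h : esymmAlgEquiv (Fin m) ℤ (Fintype.card_fin m) (X ⟨k, hk⟩) = es (k + 1) := by
        refine Subtype.ext ?_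
        rw [esymmAlgEquiv_apply, esymmAlgHom_apply, aeval_X]
      change aeval _ ((esymmAlgEquiv (Fin m) ℤ (Fintype.card_fin m)).symm (es (k + 1))) = _
      rw [← h, AlgEquiv.symm_apply_apply, aeval_X]
  have hps : ∀ k < m, Φ (ps k) = adams k a :=
    (hrel.map Φ.toRingHom).power_eq (relations a) hes
  have hps' : ∀ k < n, Φ (ps' k) = adams k (adams d a) := by
    intro k hk
    have h1 : (k + 1) * (d + 1) ≤ m := Nat.mul_le_mul_right _ hk
    have h2 : 0 < (k + 1) * (d + 1) := by positivity
    -- Indices of `ps` and `adams` are shifted by one, hence the `- 1`.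
    have h : ps' k = ps ((k + 1) * (d + 1) - 1) := by
      refine Subtype.ext ?_
      simp only [ps', ps, psum, map_sum, map_pow, expand_X]
      rw [Nat.sub_add_cancel h2]
      refine Finset.sum_congr rfl fun i _ => ?_
      rw [← pow_mul, mul_comm]
    rw [h, hps _ (by omega), adams_adams]
  -- Equal power sums give equal elementary terms, so `Φ` sends the `n`-th elementary symmetric
  -- polynomial in the `x_i ^ (d + 1)` to `λ_n(ψ_{d+1}(a))`, and the image of `Φ` consists of
  -- polynomials in the `λ_k(a)`.
  have key := (hrel'.map Φ.toRingHom).eq_of_power_eq (relations (adams d a)) hps' n le_rfl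
  refine key ▸ ?_
  change aeval _ ((esymmAlgEquiv (Fin m) ℤ (Fintype.card_fin m)).symm (es' n)) ∈ _
  refine Algebra.adjoin_mono ?_ ((Algebra.adjoin_range_eq_range_aeval ℤ
    (fun i : Fin m => lam (i + 1) a)).ge ⟨_, rfl⟩)
  rintro _ ⟨i, rfl⟩
  exact ⟨i, rfl⟩

end PowerSeriesLambda

/-! ### Reduction to elementary Lyndon compositions -/

namespace Word

theorem map_mul_lt_map_mul {d : ℕ} (hd : 0 < d) {u v : List ℕ} :
    u.map (d * ·) < v.map (d * ·) ↔ u < v := by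
  induction u generalizing v with
  | nil => cases v <;> simp
  | cons a u ih =>
    cases v with
    | nil => simp
    | cons b v =>
      rw [List.map_cons, List.map_cons, List.cons_lt_cons_iff, List.cons_lt_cons_iff, ih,
        mul_lt_mul_iff_right₀ hd, mul_right_inj' hd.ne']

theorem isLyndonWord_map_mul {d : ℕ} (hd : 0 < d) {l : List ℕ} :
    IsLyndonWord (l.map (d * ·)) ↔ IsLyndonWord l := by
  constructor
  · rintro ⟨h1, h2⟩
    refine ⟨by simpa using h1, ?_⟩
    rintro u v rfl hu hv
    rw [← map_mul_lt_map_mul hd]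
    exact h2 _ _ List.map_append (by simpa using hu) (by simpa using hv)
  · rintro ⟨h1, h2⟩
    refine ⟨by simpa using h1, fun u v huv hu hv => ?_⟩
    obtain ⟨u, v, rfl, rfl, rfl⟩ := List.map_eq_append_iff.1 huv
    rw [map_mul_lt_map_mul hd]
    exact h2 u v rfl (by simpa using hu) (by simpa using hv)

theorem gcd_map_mul (d : ℕ) (l : List ℕ) :
    ((l.map (d * ·) : List ℕ) : Multiset ℕ).gcd = d * (l : Multiset ℕ).gcd := by
  rw [← Multiset.map_coe, Multiset.gcd_map_mul, normalize_eq]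

/-- Every Lyndon composition is a multiple of an elementary one. -/
theorem exists_eq_map_mul {l : List ℕ} (hl : IsLyndonWord l) (h0 : 0 ∉ l) :
    ∃ β ∈ eLYN, ∃ d, l = β.map ((d + 1) * ·) := by
  set g := (l : Multiset ℕ).gcd with hg
  have hdvd : ∀ a ∈ l, g ∣ a := fun a ha => Multiset.gcd_dvd ha
  have hgpos : 0 < g := by
    obtain ⟨a, ha⟩ := List.exists_mem_of_ne_nil l hl.1
    refine Nat.pos_of_ne_zero fun h => h0 ?_
    have := hdvd a ha
    rw [h, zero_dvd_iff] at this
    exact this ▸ ha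
  have hl' : l = (l.map (· / g)).map (g * ·) := by
    rw [List.map_map]
    refine (List.map_id l).symm.trans (List.map_congr_left fun a ha => ?_)
    exact (Nat.mul_div_cancel' (hdvd a ha)).symm
  refine ⟨l.map (· / g), ⟨fun a ha => ?_, ?_, ?_⟩, g - 1, ?_⟩
  · obtain ⟨b, hb, rfl⟩ := List.mem_map.1 ha
    exact Nat.div_pos (Nat.le_of_dvd (Nat.pos_of_ne_zero fun h => h0 (h ▸ hb)) (hdvd b hb)) hgpos
  · rw [← isLyndonWord_map_mul hgpos, ← hl']
    exact hl
  · have h := gcd_map_mul g (l.map (· / g))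
    rw [← hl', ← hg] at h
    exact (Nat.eq_of_mul_eq_mul_left hgpos (by rw [mul_one]; exact h)).symm
  · rwa [Nat.sub_add_cancel hgpos]

end Word

/-- A Lyndon composition is `ψ_{d+1}(β)` with `β` elementary, and the lambda operations on it are
polynomials in the `e_k(β)`. -/
theorem adjoin_range_eQSymm :
    Algebra.adjoin ℤ (Set.range fun p : eLYN × ℕ+ => eQSymm (p.2 : ℕ) (p.1 : List ℕ)) =
      QSymm := by
  refine le_antisymm (Algebra.adjoin_le ?_) ?_
  · rintro _ ⟨p, rfl⟩
    exact QuasiSym.lam_monomialQSymm_mem _ _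
  · rw [← QuasiSym.adjoin_lyndonLam]
    refine Algebra.adjoin_le ?_
    rintro _ ⟨l, n, hl, h0, rfl⟩
    obtain ⟨β, hβ, d, rfl⟩ := Word.exists_eq_map_mul hl h0
    rw [← QuasiSym.adams_monomialQSymm]
    refine Algebra.adjoin_mono ?_ (PowerSeriesLambda.lam_adams_mem _ d n)
    rintro _ ⟨k, rfl⟩
    exact ⟨(⟨β, hβ⟩, ⟨k + 1, k.succ_pos⟩), rfl⟩

/-! ### Algebraic independence -/

namespace Word

/-- The concatenation of the words of a list in reverse order. -/
def revFlatten : List (List ℕ) → List ℕ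
  | [] => []
  | l :: L => revFlatten L ++ l

theorem sum_revFlatten (L : List (List ℕ)) : (revFlatten L).sum = (L.map List.sum).sum := by
  induction L with
  | nil => rfl
  | cons l L ih => rw [revFlatten, List.sum_append, ih, List.map_cons, List.sum_cons, add_comm]

theorem mem_revFlatten {L : List (List ℕ)} {a : ℕ} (h : a ∈ revFlatten L) : ∃ l ∈ L, a ∈ l := by
  induction L with
  | nil => simp [revFlatten] at h
  | cons l L ih =>
    rcases List.mem_append.1 h with h | h
    · obtain ⟨m, hm, ha⟩ := ih h
      exact ⟨m, List.mem_cons_of_mem _ hm, ha⟩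
    · exact ⟨l, List.mem_cons_self, h⟩

/-- The last factor of a nonincreasing product of Lyndon words is its minimal suffix. -/
theorem le_of_suffix_revFlatten {l : List ℕ} {L : List (List ℕ)}
    (hL : ∀ m ∈ l :: L, IsLyndonWord m) (hs : (l :: L).Pairwise (· ≤ ·)) {s : List ℕ}
    (h : s <:+ revFlatten (l :: L)) (hne : s ≠ []) : l ≤ s := by
  induction L generalizing l s with
  | nil => exact (hL l (by simp)).le_of_suffix (by simpa [revFlatten] using h) hne
  | cons m L ih =>
    rcases suffix_append_cases h with h | ⟨t, ht, htne, rfl⟩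
    · exact (hL l (by simp)).le_of_suffix h hne
    · rw [List.pairwise_cons] at hs
      -- The chain is `l ≤ m ≤ t ≤ t ++ l`, with the middle inequality from the induction
      -- hypothesis.
      exact (hs.1 m (by simp)).trans
        ((ih (fun k hk => hL k (List.mem_cons_of_mem _ hk)) hs.2 ht htne).trans (le_append t l))

/-- The factorization of a word as a nonincreasing product of Lyndon words is unique. -/
theorem revFlatten_injOn {L L' : List (List ℕ)} (hL : ∀ m ∈ L, IsLyndonWord m)
    (hs : L.Pairwise (· ≤ ·)) (hL' : ∀ m ∈ L', IsLyndonWord m) (hs' : L'.Pairwise (· ≤ ·))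
    (h : revFlatten L = revFlatten L') : L = L' := by
  induction L generalizing L' with
  | nil =>
    cases L' with
    | nil => rfl
    | cons m L' =>
      have := (hL' m (by simp)).1
      simp [revFlatten, this] at h
  | cons l L ih =>
    cases L' with
    | nil =>
      have := (hL l (by simp)).1
      simp [revFlatten, this] at h
    | cons m L' =>
      have h1 : l ≤ m := le_of_suffix_revFlatten hL hs (h ▸ List.suffix_append _ _)
        (hL' m (by simp)).1
      have h2 : m ≤ l := le_of_suffix_revFlatten hL' hs' (h ▸ List.suffix_append _ _)
        (hL l (by simp)).1
      obtain rfl := le_antisymm h1 h2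
      rw [ih (fun k hk => hL k (List.mem_cons_of_mem _ hk)) (List.pairwise_cons.1 hs).2
        (fun k hk => hL' k (List.mem_cons_of_mem _ hk)) (List.pairwise_cons.1 hs').2
        (List.append_cancel_right h)]

/-- The Lyndon composition `k • β`. -/
def multiple (p : eLYN × ℕ+) : List ℕ := (p.1 : List ℕ).map ((p.2 : ℕ) * ·)

theorem isLyndonWord_multiple (p : eLYN × ℕ+) : IsLyndonWord (multiple p) :=
  (isLyndonWord_map_mul p.2.pos).2 p.1.2.2.1

theorem zero_notMem_multiple (p : eLYN × ℕ+) : 0 ∉ multiple p := by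
  intro h
  obtain ⟨a, ha, h⟩ := List.mem_map.1 h
  exact (Nat.mul_pos p.2.pos (p.1.2.1 a ha)).ne' h

/-- The factor `k` is recovered as the gcd of the entries of `kβ`. -/
theorem multiple_injective : Function.Injective multiple := by
  intro p q h
  have hk : (p.2 : ℕ) = q.2 := by
    have := congrArg (fun l : List ℕ => (l : Multiset ℕ).gcd) h
    simpa only [multiple, gcd_map_mul, p.1.2.2.2, q.1.2.2.2, mul_one] using this
  refine Prod.ext (Subtype.ext ?_) (PNat.coe_injective hk)
  rw [multiple, multiple, hk] at h
  exact List.map_injective_iff.2 (mul_right_injective₀ q.2.pos.ne') h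

/-- The nonincreasing product of the Lyndon words `k • β` for the variables of a monomial. -/
noncomputable def ofMonomial (m : eLYN × ℕ+ →₀ ℕ) : List ℕ :=
  revFlatten (((Finsupp.toMultiset m).map multiple).sort (· ≤ ·))

theorem exists_eq_multiple_of_mem {m : eLYN × ℕ+ →₀ ℕ} {l : List ℕ}
    (h : l ∈ ((Finsupp.toMultiset m).map multiple).sort (· ≤ ·)) : ∃ p, multiple p = l := by
  rw [Multiset.mem_sort, Multiset.mem_map] at h
  obtain ⟨p, _, hp⟩ := h
  exact ⟨p, hp⟩

/-- These words serve only to count monomials, with `kβ` standing for the variable of `(β, k)`;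
nothing is claimed about leading words. The multiset of factors is recovered by unique
factorization. -/
theorem ofMonomial_injective : Function.Injective ofMonomial := by
  have hL : ∀ (m : eLYN × ℕ+ →₀ ℕ), ∀ l ∈ ((Finsupp.toMultiset m).map multiple).sort (· ≤ ·),
      IsLyndonWord l := by
    intro m l hl
    obtain ⟨p, rfl⟩ := exists_eq_multiple_of_mem hl
    exact isLyndonWord_multiple p
  intro m m' h
  have h1 := revFlatten_injOn (hL m) (Multiset.pairwise_sort _ _) (hL m')
    (Multiset.pairwise_sort _ _) h
  have h2 := congrArg (fun L : List (List ℕ) => (L : Multiset (List ℕ))) h1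
  simp only [Multiset.sort_eq] at h2
  classical
  exact Multiset.toFinsupp.symm.injective (Multiset.map_injective multiple_injective h2)

theorem zero_notMem_ofMonomial (m : eLYN × ℕ+ →₀ ℕ) : 0 ∉ ofMonomial m := by
  intro h
  obtain ⟨l, hl, h⟩ := mem_revFlatten h
  obtain ⟨p, rfl⟩ := exists_eq_multiple_of_mem hl
  exact zero_notMem_multiple p h

/-- The right side is the degree of the product of the corresponding `e_k(β)`, so the count respects
the grading. -/
theorem sum_ofMonomial (m : eLYN × ℕ+ →₀ ℕ) :
    (ofMonomial m).sum = m.sum fun p e => e * ((p.2 : ℕ) * (p.1 : List ℕ).sum) := by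
  have h : ∀ m : eLYN × ℕ+ →₀ ℕ, (((Finsupp.toMultiset m).map multiple).map List.sum).sum =
      m.sum fun p e => e * ((p.2 : ℕ) * (p.1 : List ℕ).sum) := by
    intro m
    induction m using Finsupp.induction_linear with
    | zero => simp
    | add f g hf hg =>
      rw [Finsupp.toMultiset_add, Multiset.map_add, Multiset.map_add, Multiset.sum_add, hf, hg,
        Finsupp.sum_add_index' (by simp) (fun _ _ _ => add_mul _ _ _)]
    | single p e =>
      rw [Finsupp.toMultiset_single, Finsupp.sum_single_index (zero_mul _), Multiset.map_nsmul,
        Multiset.map_nsmul, Multiset.sum_nsmul]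
      have hp : (multiple p).sum = p.2 * (p.1 : List ℕ).sum := by
        simpa [multiple] using List.sum_map_mul_left (p.1 : List ℕ) id (p.2 : ℕ)
      simp [hp]
  rw [ofMonomial, sum_revFlatten, ← Multiset.sum_coe, ← Multiset.map_coe, Multiset.sort_eq, h]

end Word

/-! ### Comparing monomials in the generators with compositions, degree by degree -/

namespace QuasiSym

open Word

theorem isHomogeneousOfDegree_prod_eQSymm (m : eLYN × ℕ+ →₀ ℕ) :
    IsHomogeneousOfDegree (ofMonomial m).sum
      (m.prod fun p e => eQSymm (p.2 : ℕ) (p.1 : List ℕ) ^ e) := by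
  rw [sum_ofMonomial]
  exact isHomogeneousOfDegree_prod _ fun p _ => (isHomogeneousOfDegree_lam _ _).pow _

/-- The coefficients of the images of the monomials of weight `N` at the words of weight `N`. -/
noncomputable def coeffMap (N : ℕ) :
    ({m : eLYN × ℕ+ →₀ ℕ // (ofMonomial m).sum = N} →₀ ℤ) →ₗ[ℤ] (Composition N → ℤ) :=
  Finsupp.linearCombination ℤ fun m c =>
    wcoeff c.blocks (m.1.prod fun p e => eQSymm (p.2 : ℕ) (p.1 : List ℕ) ^ e)

/-- The coefficients of a polynomial at the monomials of weight `N`. -/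
noncomputable def weightPart (N : ℕ) (q : MvPolynomial (eLYN × ℕ+) ℤ) :
    {m : eLYN × ℕ+ →₀ ℕ // (ofMonomial m).sum = N} →₀ ℤ :=
  Finsupp.onFinset (q.support.subtype fun m => (ofMonomial m).sum = N)
    (fun m => MvPolynomial.coeff m.1 q) fun m hm => by simpa using hm

theorem coeffMap_weightPart {N : ℕ} (q : MvPolynomial (eLYN × ℕ+) ℤ) (c : Composition N) :
    coeffMap N (weightPart N q) c = wcoeff c.blocks
      (MvPolynomial.aeval (fun p : eLYN × ℕ+ => eQSymm (p.2 : ℕ) (p.1 : List ℕ)) q) := by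
  have h : MvPolynomial.aeval (fun p : eLYN × ℕ+ => eQSymm (p.2 : ℕ) (p.1 : List ℕ)) q =
      ∑ m ∈ q.support, MvPolynomial.coeff m q •
        m.prod fun p e => eQSymm (p.2 : ℕ) (p.1 : List ℕ) ^ e := by
    rw [MvPolynomial.aeval_def, MvPolynomial.eval₂_eq]
    refine Finset.sum_congr rfl fun m _ => ?_
    rw [← Algebra.smul_def]
    rfl
  rw [h, coeffMap, Finsupp.linearCombination_apply, weightPart,
    Finsupp.onFinset_sum _ (fun a => zero_smul ℤ (fun c : Composition N => wcoeff c.blocks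
      (a.1.prod fun p e => eQSymm (p.2 : ℕ) (p.1 : List ℕ) ^ e))), Finset.sum_apply, map_sum,
    Finset.sum_subtype_eq_sum_filter (f := fun m => (MvPolynomial.coeff m q •
      fun c : Composition N => wcoeff c.blocks
        (m.prod fun p e => eQSymm (p.2 : ℕ) (p.1 : List ℕ) ^ e)) c),
    Finset.sum_filter]
  refine Finset.sum_congr rfl fun m _ => ?_
  rw [map_zsmul]
  split_ifs with hm
  · rfl
  -- Monomials of another weight have no coefficient at a composition of `N`, by homogeneity.
  · by_contra hne
    refine hm ?_
    rw [← (wcoeff_eq_zero_of_degree (isHomogeneousOfDegree_prod_eQSymm m)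
      (right_ne_zero_of_smul (Ne.symm hne))).2, c.blocks_sum]

/-- This is generation in degree `N`: prescribed coefficients come from a polynomial in the
generators, of which only the weight `N` part matters. -/
theorem coeffMap_surjective (N : ℕ) : Function.Surjective (coeffMap N) := by
  intro g
  have hmem : ∑ c : Composition N, g c • monomialQSymm c.blocks ∈ QSymm :=
    sum_mem fun c _ => zsmul_mem (monomialQSymm_mem _) _
  rw [← adjoin_range_eQSymm, Algebra.adjoin_range_eq_range_aeval] at hmem
  obtain ⟨q, hq⟩ := hmem
  refine ⟨weightPart N q, funext fun c => ?_⟩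
  rw [coeffMap_weightPart]
  refine (congrArg (wcoeff c.blocks) hq).trans ?_
  simp only [map_sum, map_zsmul, wcoeff_monomialQSymm (zero_notMem_blocks _)]
  rw [Finset.sum_eq_single c]
  · simp
  · intro d _ hd
    rw [Pi.single_eq_of_ne, smul_zero]
    exact fun h => hd (Composition.ext h.symm)
  · simp

/-- The source is free on a set that embeds in the compositions of `N`, so its rank is at most that
of the target, and surjectivity forces injectivity. -/
theorem coeffMap_injective (N : ℕ) : Function.Injective (coeffMap N) := by
  let j : {m : eLYN × ℕ+ →₀ ℕ // (ofMonomial m).sum = N} → Composition N :=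
    fun m => toComposition (ofMonomial m.1) (zero_notMem_ofMonomial m.1) m.2
  have hj : Function.Injective j := fun m m' h =>
    Subtype.ext (ofMonomial_injective (congrArg Composition.blocks h))
  let i : ({m : eLYN × ℕ+ →₀ ℕ // (ofMonomial m).sum = N} →₀ ℤ) →ₗ[ℤ] (Composition N → ℤ) :=
    (Finsupp.linearEquivFunOnFinite ℤ ℤ (Composition N)).toLinearMap ∘ₗ
    Finsupp.lmapDomain ℤ ℤ j
  -- Orzech's theorem: a surjection onto a finitely generated module over a commutative ring, from a
  -- module that embeds in it, is injective.
  refine OrzechProperty.injective_of_surjective_of_injective i (coeffMap N) ?_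
    (coeffMap_surjective N)
  exact (Finsupp.linearEquivFunOnFinite ℤ ℤ (Composition N)).injective.comp
    (Finsupp.mapDomain_injective hj)

end QuasiSym

theorem algebraicIndependent_eQSymm :
    AlgebraicIndependent ℤ (fun p : eLYN × ℕ+ => eQSymm (p.2 : ℕ) (p.1 : List ℕ)) := by
  rw [algebraicIndependent_iff_injective_aeval, injective_iff_map_eq_zero]
  intro q hq
  ext m
  -- The coefficient of `m` is an entry of the part of `q` of the weight of `m`, and each such part
  -- maps to zero separately.
  have h : QuasiSym.coeffMap (Word.ofMonomial m).sum (QuasiSym.weightPart _ q) = 0 := by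
    funext c
    rw [QuasiSym.coeffMap_weightPart, hq, map_zero]
    rfl
  have h0 := QuasiSym.coeffMap_injective _ (h.trans (map_zero _).symm)
  exact DFunLike.congr_fun h0 ⟨m, rfl⟩

theorem theorem2p1 :
    AlgebraicIndependent ℤ (fun p : eLYN × ℕ+ => eQSymm (p.2 : ℕ) (p.1 : List ℕ)) ∧
    Algebra.adjoin ℤ (Set.range fun p : eLYN × ℕ+ => eQSymm (p.2 : ℕ) (p.1 : List ℕ)) = QSymm ∧
    ∃ φ : MvPolynomial (eLYN × ℕ+) ℤ ≃ₐ[ℤ] QSymm, ∀ p : eLYN × ℕ+,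
      (φ (MvPolynomial.X p) : MvPowerSeries ℕ ℤ) = eQSymm (p.2 : ℕ) (p.1 : List ℕ) := by
  refine ⟨algebraicIndependent_eQSymm, adjoin_range_eQSymm,
    algebraicIndependent_eQSymm.aevalEquiv.trans (Subalgebra.equivOfEq _ _ adjoin_range_eQSymm),
    fun p => ?_⟩
  simp
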